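/- A lattice path starting at $(0,0)$ and made of unit east and unit north steps is called NW-convex if it begins and ends with a north step and no unit cell of the square lattice lies between the path and its upper convex hull (that is, no unit cell on the upper left side of the path is contained in the convex hull of the path). Its size is its number of steps. For a real number $x\ge 0$, the point of slope $x$ of such a path is the point at which the part of its upper convex hull of slope greater than $x$ ends, i.e. the first point of the path at which $Y-xX$ is maximal among the points $(X,Y)$ of the path; for $x=0$ it is the end point of the path. Let $(X_n(x),Y_n(x))$ be the point of slope $x$ of a uniformly random NW-convex path of size $n$. Then for every fixed $x\ge 0$, as $n\to\infty$, $$\mathbb E\!\left[\frac{Y_n(x)}{n}\right]\longrightarrow \frac12\left(1-\left(\frac{x}{1+x}\right)^2\right)\qquad\text{and}\qquad \mathbb E\!\left[\frac{X_n(x)}{n}\right]\longrightarrow \frac{1}{2(1+x)^2}.$$ -/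

import Mathlib

open Filter Topology

/-- The lattice point reached from `(0,0)` after the first `i` letters of the word `w`:
`false` (the letter 0) is a unit east step, `true` (the letter 1) is a unit north step.
For `i ≥ w.length` this is the end point of the path. -/
def pathPoint (w : List Bool) (i : ℕ) : ℝ × ℝ :=
  (((w.take i).count false : ℝ), ((w.take i).count true : ℝ))

/-- The convex hull of the path coded by `w`. -/
def pathHull (w : List Bool) : Set (ℝ × ℝ) :=
  convexHull ℝ (Set.range (pathPoint w))

/-- The closed unit cell of the square lattice with lower left corner `(a, b)`. -/
def unitCell (a b : ℤ) : Set (ℝ × ℝ) :=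
  Set.Icc (a : ℝ) (a + 1) ×ˢ Set.Icc (b : ℝ) (b + 1)

/-- The cell with lower left corner `(a, b)` is on the upper left (north-west) side of the path:
its lower right corner is weakly to the north-west of some lattice point of the path. -/
def CellAbovePath (w : List Bool) (a b : ℤ) : Prop :=
  ∃ i : ℕ, (a : ℝ) + 1 ≤ (pathPoint w i).1 ∧ (pathPoint w i).2 ≤ (b : ℝ)

/-- A path is NW-convex if it begins and ends with a north step and no cell lies between the path
and its upper convex hull, i.e. no cell above the path is contained in the convex hull. -/
def NWConvex (w : List Bool) : Prop :=
  w.head? = some true ∧ w.getLast? = some true ∧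
    ∀ a b : ℤ, CellAbovePath w a b → ¬ (unitCell a b ⊆ pathHull w)

open Classical in
/-- The finite set of NW-convex paths of size (number of steps) `n`. -/
noncomputable def nwPaths (n : ℕ) : Finset (List Bool) :=
  (List.finite_length_eq Bool n).toFinset.filter NWConvex

/-- `v ↦ v.2 - x * v.1` along the path: it tells how far the line of slope `x` through the `i`-th
point is shifted upwards. -/
noncomputable def slopeHeight (w : List Bool) (x : ℝ) (i : ℕ) : ℝ :=
  (pathPoint w i).2 - x * (pathPoint w i).1

/-- The point of slope `x` of the path: the first point of the path lying on its upper supporting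
line of slope `x`. It is the vertex of the upper convex hull that ends the part of the hull
where the slope is greater than `x`. -/
noncomputable def slopePoint (w : List Bool) (x : ℝ) : ℝ × ℝ :=
  pathPoint w (sInf {i : ℕ | ∀ j : ℕ, slopeHeight w x j ≤ slopeHeight w x i})

/-- The set whose infimum defines the point of slope `x` is never empty. -/
theorem exists_slopeHeight_max (w : List Bool) (x : ℝ) :
    {i : ℕ | ∀ j : ℕ, slopeHeight w x j ≤ slopeHeight w x i}.Nonempty := by
  obtain ⟨i, -, hi⟩ := Finset.exists_max_image (Finset.range (w.length + 1)) (slopeHeight w x)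
    ⟨0, by simp⟩
  refine ⟨i, fun j => ?_⟩
  by_cases hj : j ≤ w.length
  · exact hi j (by simp; omega)
  · have h1 : slopeHeight w x j = slopeHeight w x w.length := by
      simp [slopeHeight, pathPoint, List.take_of_length_le (le_of_not_ge hj)]
    rw [h1]
    exact hi _ (by simp)

/-- The expectation of `f` over a uniformly random NW-convex path of size `n`. -/
noncomputable def nwMean (n : ℕ) (f : List Bool → ℝ) : ℝ :=
  (∑ w ∈ nwPaths n, f w) / ((nwPaths n).card : ℝ)

/-! Encode a primitive vector with `b` north steps among `d` steps by the rational `q = b / d`, its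
proportion of north steps; slope `x` becomes `q = x / (1 + x)`. The lattice path closest below that
vector is the Christoffel word of `q`. A path has no cell in its upper hull exactly when it is a
concatenation of Christoffel words of weakly decreasing `q` (`noCellInHull_christoffelPath`,
`exists_christoffelPath_eq`). A first north step forces `q = 1` to occur, a last one excludes `q =
0`. So NW-convex paths of size `N + 1` correspond to multisets of rationals in `(0, 1]` with
denominators summing to `N` (`sum_nwPaths_succ`), and the point of slope `x` is a sum over the
slopes above `x / (1 + x)`.

Over all these multisets, the total multiplicity of a slope depends only on its denominator
(`totalCount_eq_of_den_eq`). Hence the mean is a weighted average over `d` of the averages of a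
function `f` over the reduced fractions of denominator `d`. Two facts give the limit: a fixed
denominator has vanishing weight (`totalCount_le`, `tendsto_sum_card_slopeFinset_div`), and reduced
fractions of large denominator are equidistributed in `(0, 1]`, by Möbius inversion
(`exists_abs_sum_slopesOfDen_sub_le`). No asymptotics for the number of paths are needed. With `θ =
x / (1 + x)` the limits are the integrals of `t` and `1 - t` over `[θ, 1]`. -/

/-- Two words of the same length whose prefixes contain equally many north steps coincide. -/
theorem eq_of_count_take {u v : List Bool} (hl : u.length = v.length)
    (h : ∀ k ≤ u.length, (u.take k).count true = (v.take k).count true) : u = v := by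
  refine List.ext_getElem hl fun k hk hk' => ?_
  have h1 := h k hk.le
  have h2 := h (k + 1) hk
  rw [List.take_succ_eq_append_getElem hk, List.take_succ_eq_append_getElem hk',
    List.count_append, List.count_append, h1] at h2
  cases hu : u[k] <;> cases hv : v[k] <;> simp_all

/-- The number of north steps increases by one exactly at a letter `true`. -/
theorem count_take_succ (w : List Bool) {k : ℕ} (hk : k < w.length) :
    (w.take (k + 1)).count true = (w.take k).count true + if w[k] then 1 else 0 := by
  rw [List.take_succ_eq_append_getElem hk, List.count_append]
  cases w[k] <;> simp

theorem count_take_append (u v : List Bool) (k : ℕ) :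
    ((u ++ v).take (u.length + k)).count true = u.count true + (v.take k).count true := by
  rw [List.take_append, List.count_append, List.take_of_length_le (by omega)]
  simp

theorem count_false_take (w : List Bool) (k : ℕ) (hk : k ≤ w.length) :
    (((w.take k).count false : ℕ) : ℝ) = k - ((w.take k).count true : ℕ) := by
  have := List.count_false_add_count_true (w.take k)
  rw [List.length_take, min_eq_left hk] at this
  rw [eq_sub_iff_add_eq]; exact_mod_cast this

/-! ### Christoffel words -/

/-- The Christoffel word of the rational number `q ∈ [0, 1]`: it has `q.den` letters, and its first
`j` letters contain `⌊q * j⌋` north steps. -/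
def christoffel (q : ℚ) : List Bool :=
  (List.range q.den).map fun j : ℕ => decide (⌊q * j⌋ < ⌊q * (j + 1)⌋)

@[simp] theorem length_christoffel (q : ℚ) : (christoffel q).length = q.den := by
  simp [christoffel]

/-- For `q` in `[0, 1]` the floor never jumps by more than one, so a single letter records each
jump. -/
theorem floor_mul_succ {q : ℚ} (h0 : 0 ≤ q) (h1 : q ≤ 1) (j : ℕ) :
    ⌊q * (j + 1)⌋ = ⌊q * j⌋ + if ⌊q * j⌋ < ⌊q * (j + 1)⌋ then 1 else 0 := by
  have h2 : ⌊q * j⌋ ≤ ⌊q * (j + 1)⌋ := Int.floor_le_floor (by nlinarith)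
  have h3 : ⌊q * (j + 1)⌋ ≤ ⌊q * j⌋ + 1 := by
    rw [← Int.floor_add_one]; exact Int.floor_le_floor (by nlinarith)
  split_ifs <;> omega

theorem count_take_christoffel {q : ℚ} (h0 : 0 ≤ q) (h1 : q ≤ 1) {j : ℕ} (hj : j ≤ q.den) :
    ((((christoffel q).take j).count true : ℕ) : ℤ) = ⌊q * j⌋ := by
  induction j with
  | zero => simp
  | succ j ih =>
    rw [count_take_succ _ (by simpa using hj)]
    push_cast
    rw [ih (by omega), floor_mul_succ h0 h1]
    simp [christoffel]

theorem count_christoffel {q : ℚ} (h0 : 0 ≤ q) (h1 : q ≤ 1) :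
    (((christoffel q).count true : ℕ) : ℤ) = q.num := by
  have := count_take_christoffel h0 h1 le_rfl
  rw [← length_christoffel, List.take_length] at this
  rw [this, length_christoffel, Rat.mul_den_eq_num]; simp

theorem count_christoffel_rat {q : ℚ} (h0 : 0 ≤ q) (h1 : q ≤ 1) :
    (((christoffel q).count true : ℕ) : ℚ) = q * q.den := by
  rw [Rat.mul_den_eq_num, ← count_christoffel h0 h1]; simp

theorem count_take_christoffel_le {q : ℚ} (h0 : 0 ≤ q) (h1 : q ≤ 1) {j : ℕ} (hj : j ≤ q.den) :
    ((((christoffel q).take j).count true : ℕ) : ℚ) ≤ q * j := by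
  have := count_take_christoffel h0 h1 hj
  have h2 := Int.floor_le (q * j)
  rw [← this] at h2
  exact_mod_cast h2

theorem lt_count_take_christoffel {q : ℚ} (h0 : 0 ≤ q) (h1 : q ≤ 1) {j : ℕ} (hj : j ≤ q.den) :
    q * j < ((((christoffel q).take j).count true : ℕ) : ℚ) + 1 := by
  have := count_take_christoffel h0 h1 hj
  have h2 := Int.lt_floor_add_one (q * j)
  rw [← this] at h2
  exact_mod_cast h2

theorem christoffel_ne_nil (q : ℚ) : christoffel q ≠ [] := by
  rw [← List.length_pos_iff_ne_nil]; simp [q.den_pos]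

/-! ### Concatenations of Christoffel words -/

/-- The concatenation of the Christoffel words of a list of rational numbers. -/
def christoffelPath (L : List ℚ) : List Bool := L.flatMap christoffel

@[simp] theorem christoffelPath_nil : christoffelPath [] = [] := rfl

@[simp] theorem christoffelPath_cons (q : ℚ) (L : List ℚ) :
    christoffelPath (q :: L) = christoffel q ++ christoffelPath L := rfl

theorem length_christoffelPath (L : List ℚ) :
    (christoffelPath L).length = (L.map Rat.den).sum := by
  induction L <;> simp_all

/-- If all slopes are at most `c` then the path stays below the line of slope `c`. -/
theorem count_take_christoffelPath_le {L : List ℚ} (hL : ∀ q ∈ L, 0 ≤ q ∧ q ≤ 1) {c : ℝ}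
    (hc : ∀ q ∈ L, (q : ℝ) ≤ c) {j : ℕ} (hj : j ≤ (christoffelPath L).length) :
    ((((christoffelPath L).take j).count true : ℕ) : ℝ) ≤ c * j := by
  induction L generalizing j with
  | nil => simp at hj; simp [hj]
  | cons q L ih =>
    obtain ⟨h0, h1⟩ := hL q (by simp)
    have hq := hc q (by simp)
    by_cases hjq : j ≤ q.den
    · rw [christoffelPath_cons, List.take_append_of_le_length (by simpa using hjq)]
      have := count_take_christoffel_le h0 h1 hjq
      have h2 : ((((christoffel q).take j).count true : ℕ) : ℝ) ≤ q * j := by exact_mod_cast this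
      have : (0 : ℝ) ≤ j := by positivity
      nlinarith
    · obtain ⟨k, rfl⟩ := Nat.exists_eq_add_of_le (not_le.mp hjq).le
      have e := count_take_append (christoffel q) (christoffelPath L) k
      rw [length_christoffel] at e
      rw [christoffelPath_cons, e]
      have h3 := ih (fun p hp => hL p (by simp [hp])) (fun p hp => hc p (by simp [hp])) (j := k)
        (by simp at hj; omega)
      have h2 : (((christoffel q).count true : ℕ) : ℝ) = q * q.den := by
        exact_mod_cast count_christoffel_rat h0 h1
      have : (0 : ℝ) ≤ q.den := by positivity
      push_cast
      nlinarith

/-- Lists of slopes with decreasing entries are determined by their paths. -/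
theorem christoffelPath_injective {L L' : List ℚ} (hL : ∀ q ∈ L, 0 ≤ q ∧ q ≤ 1)
    (hL' : ∀ q ∈ L', 0 ≤ q ∧ q ≤ 1) (hs : L.Pairwise (· ≥ ·)) (hs' : L'.Pairwise (· ≥ ·))
    (h : christoffelPath L = christoffelPath L') : L = L' := by
  -- At index `p.den` the left path lies on its line of slope `p`, while the right path is weakly
  -- below its line of slope `q`.
  have key : ∀ (p q : ℚ) (L L' : List ℚ), (∀ r ∈ p :: L, 0 ≤ r ∧ r ≤ 1) →
      (∀ r ∈ q :: L', 0 ≤ r ∧ r ≤ 1) → (q :: L').Pairwise (· ≥ ·) →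
      christoffelPath (p :: L) = christoffelPath (q :: L') → p ≤ q := by
    intro p q L L' hL hL' hs' h
    have h1 := count_take_christoffelPath_le hL' (c := q) (j := p.den) (by
      intro r hr
      rcases List.mem_cons.mp hr with rfl | hr
      · exact le_rfl
      · exact_mod_cast (List.pairwise_cons.mp hs').1 r hr) (by rw [← h]; simp)
    rw [← h, christoffelPath_cons, List.take_append_of_le_length (by simp),
      List.take_of_length_le (by simp)] at h1
    obtain ⟨h2, h3⟩ := hL p (by simp)
    have h4 : (((christoffel p).count true : ℕ) : ℝ) = p * p.den := by
      exact_mod_cast count_christoffel_rat h2 h3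
    rw [h4] at h1
    have h5 : (0 : ℝ) < p.den := by exact_mod_cast p.den_pos
    exact_mod_cast le_of_mul_le_mul_right h1 h5
  induction L generalizing L' with
  | nil =>
    cases L' with
    | nil => rfl
    | cons q L' => simp [christoffel_ne_nil] at h
  | cons p L ih =>
    cases L' with
    | nil => simp [christoffel_ne_nil] at h
    | cons q L' =>
      obtain rfl : p = q := le_antisymm (key p q L L' hL hL' hs' h) (key q p L' L hL' hL hs h.symm)
      rw [christoffelPath_cons, christoffelPath_cons, List.append_cancel_left_eq] at h
      rw [ih (fun r hr => hL r (by simp [hr])) (fun r hr => hL' r (by simp [hr]))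
        (List.pairwise_cons.mp hs).2 (List.pairwise_cons.mp hs').2 h]

/-! ### The point of slope `x` -/

theorem pathPoint_append_add (u v : List Bool) (k : ℕ) :
    pathPoint (u ++ v) (u.length + k) = pathPoint u u.length + pathPoint v k := by
  simp [pathPoint, List.take_append, List.take_of_length_le (Nat.le_add_right u.length k)]

theorem pathPoint_append_of_le (u v : List Bool) {k : ℕ} (hk : k ≤ u.length) :
    pathPoint (u ++ v) k = pathPoint u k := by
  simp [pathPoint, List.take_append_of_le_length hk]

theorem pathPoint_of_length_le (w : List Bool) {k : ℕ} (hk : w.length ≤ k) :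
    pathPoint w k = pathPoint w w.length := by
  simp [pathPoint, List.take_of_length_le hk]

theorem pathPoint_eq (w : List Bool) {k : ℕ} (hk : k ≤ w.length) :
    pathPoint w k = ((k : ℝ) - ((w.take k).count true : ℕ), (((w.take k).count true : ℕ) : ℝ)) := by
  rw [pathPoint, count_false_take w k hk]

/-- After `k` steps, `T` of them north, `Y = T` and `X = k - T`. The sign of the height thus
compares `T / k` with `x / (1 + x)`. -/
theorem slopeHeight_eq (w : List Bool) (x : ℝ) {k : ℕ} (hk : k ≤ w.length) :
    slopeHeight w x k = (1 + x) * ((w.take k).count true : ℕ) - x * k := by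
  rw [slopeHeight, pathPoint_eq w hk]; ring

theorem slopeHeight_of_length_le (w : List Bool) (x : ℝ) {k : ℕ} (hk : w.length ≤ k) :
    slopeHeight w x k = slopeHeight w x w.length := by
  rw [slopeHeight, slopeHeight, pathPoint_of_length_le w hk]

theorem slopePoint_eq {w : List Bool} {x : ℝ} {i : ℕ}
    (h1 : ∀ j, slopeHeight w x j ≤ slopeHeight w x i)
    (h2 : ∀ j < i, slopeHeight w x j < slopeHeight w x i) :
    slopePoint w x = pathPoint w i := by
  have : IsLeast {i : ℕ | ∀ j : ℕ, slopeHeight w x j ≤ slopeHeight w x i} i := by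
    refine ⟨h1, fun k hk => ?_⟩
    by_contra h
    exact absurd (h2 k (not_le.mp h)) (not_lt.mpr (hk i))
  rw [slopePoint, this.csInf_eq]

theorem exists_slopePoint_eq (w : List Bool) (x : ℝ) :
    ∃ i, (∀ j, slopeHeight w x j ≤ slopeHeight w x i) ∧
      (∀ j < i, slopeHeight w x j < slopeHeight w x i) ∧ slopePoint w x = pathPoint w i := by
  have h := Nat.sInf_mem (exists_slopeHeight_max w x)
  refine ⟨_, h, fun j hj => ?_, rfl⟩
  have h2 := Nat.notMem_of_lt_sInf hj
  simp only [Set.mem_ofPred_eq, not_forall, not_le] at h2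
  obtain ⟨k, hk⟩ := h2
  exact hk.trans_le (h k)

/-- A prefix on which the height stays below its final value contributes its end point. -/
theorem slopePoint_append {u v : List Bool} {x : ℝ}
    (h : ∀ j < u.length, slopeHeight u x j < slopeHeight u x u.length) :
    slopePoint (u ++ v) x = pathPoint u u.length + slopePoint v x := by
  obtain ⟨i, h1, h2, h3⟩ := exists_slopePoint_eq v x
  have hadd : ∀ k, slopeHeight (u ++ v) x (u.length + k) =
      slopeHeight u x u.length + slopeHeight v x k := fun k => by
    simp only [slopeHeight, pathPoint_append_add, Prod.fst_add, Prod.snd_add]; ring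
  have hle : ∀ k < u.length, slopeHeight (u ++ v) x k = slopeHeight u x k := fun k hk => by
    rw [slopeHeight, pathPoint_append_of_le _ _ hk.le, slopeHeight]
  have h0 : 0 ≤ slopeHeight v x i := by simpa [slopeHeight, pathPoint] using h1 0
  rw [h3, ← pathPoint_append_add]
  refine slopePoint_eq (fun j => ?_) fun j hj => ?_
  · rcases lt_or_ge j u.length with hj | hj
    · rw [hle j hj, hadd]; linarith [h j hj]
    · obtain ⟨k, rfl⟩ := Nat.exists_eq_add_of_le hj
      rw [hadd, hadd]; linarith [h1 k]
  · rcases lt_or_ge j u.length with hj' | hj'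
    · rw [hle j hj', hadd]; linarith [h j hj']
    · obtain ⟨k, rfl⟩ := Nat.exists_eq_add_of_le hj'
      rw [hadd, hadd]; linarith [h2 k (by omega)]

theorem slopePoint_christoffelPath_of_le {L : List ℚ} (hL : ∀ q ∈ L, 0 ≤ q ∧ q ≤ 1) {x : ℝ}
    (hx : 0 ≤ x) (h : ∀ q ∈ L, (q : ℝ) ≤ x / (1 + x)) :
    slopePoint (christoffelPath L) x = 0 := by
  have key : ∀ j ≤ (christoffelPath L).length, slopeHeight (christoffelPath L) x j ≤ 0 := by
    intro j hj
    rw [slopeHeight_eq _ _ hj]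
    have h1 := count_take_christoffelPath_le hL h hj
    have h2 : (0 : ℝ) < 1 + x := by linarith
    have h3 := mul_le_mul_of_nonneg_left h1 h2.le
    have h4 : (1 + x) * (x / (1 + x) * j) = x * j := by field_simp
    linarith
  have h0 : slopeHeight (christoffelPath L) x 0 = 0 := by simp [slopeHeight, pathPoint]
  rw [slopePoint_eq (i := 0)]
  · simp [pathPoint]
  · intro j
    rw [h0]
    rcases le_total j (christoffelPath L).length with hj | hj
    · exact key j hj
    · rw [slopeHeight_of_length_le _ _ hj]; exact key _ le_rfl
  · simp

/-- The point of slope `x` of a path made of Christoffel words with decreasing slopes. -/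
theorem slopePoint_christoffelPath {L : List ℚ} (hL : ∀ q ∈ L, 0 ≤ q ∧ q ≤ 1)
    (hs : L.Pairwise (· ≥ ·)) {x : ℝ} (hx : 0 ≤ x) :
    slopePoint (christoffelPath L) x =
      ((L.map fun q : ℚ => if x / (1 + x) < q then (q.den : ℝ) * (1 - q) else 0).sum,
       (L.map fun q : ℚ => if x / (1 + x) < q then (q.den : ℝ) * q else 0).sum) := by
  induction L with
  | nil => exact slopePoint_christoffelPath_of_le hL hx (by simp)
  | cons q L ih =>
    obtain ⟨hq, hs'⟩ := List.pairwise_cons.mp hs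
    by_cases hqx : x / (1 + x) < q
    · have h2 : (0 : ℝ) < 1 + x := by linarith
      obtain ⟨h0, h1⟩ := hL q (by simp)
      have hc : (((christoffel q).count true : ℕ) : ℝ) = q * q.den := by
        exact_mod_cast count_christoffel_rat h0 h1
      have hxq : x < (1 + x) * q := by rw [div_lt_iff₀ h2] at hqx; linarith
      rw [christoffelPath_cons, slopePoint_append, ih (fun p hp => hL p (by simp [hp])) hs',
        pathPoint_eq _ le_rfl, List.take_length, hc]
      · simp [hqx]
        constructor <;> ring
      -- Below the chord the height is at most `((1 + x) * q - x) * j`, whose coefficient is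
      -- positive, so the end of the word is strictly highest.
      · intro j hj
        rw [slopeHeight_eq _ _ hj.le, slopeHeight_eq _ _ le_rfl, List.take_length, hc]
        rw [length_christoffel] at hj ⊢
        have h3 : ((((christoffel q).take j).count true : ℕ) : ℝ) ≤ q * j := by
          exact_mod_cast count_take_christoffel_le h0 h1 hj.le
        have h4 : (j : ℝ) < q.den := by exact_mod_cast hj
        nlinarith
    · have h1 : ∀ p ∈ q :: L, (p : ℝ) ≤ x / (1 + x) := by
        intro p hp
        rcases List.mem_cons.mp hp with rfl | hp
        · exact not_lt.mp hqx
        · exact le_trans (by exact_mod_cast hq p hp) (not_lt.mp hqx)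
      rw [slopePoint_christoffelPath_of_le hL hx h1]
      have hz : ∀ f : ℚ → ℝ, ((q :: L).map fun q : ℚ => if x / (1 + x) < q then f q else 0).sum
          = 0 := by
        intro f
        refine List.sum_eq_zero fun y hy => ?_
        obtain ⟨p, hp, rfl⟩ := List.mem_map.mp hy
        exact if_neg (not_lt.mpr (h1 p hp))
      rw [hz, hz]; rfl

/-! ### Decreasing concatenations have no cell in the hull -/

/-- Above every east step of a path made of Christoffel words with decreasing slopes there is a
supporting line of the path which passes below the point one unit north of the step. -/
theorem exists_support_of_east_step {L : List ℚ} (hL : ∀ q ∈ L, 0 ≤ q ∧ q ≤ 1)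
    (hs : L.Pairwise (· ≥ ·)) {j : ℕ} (hj : j < (christoffelPath L).length)
    (hE : (christoffelPath L)[j] = false) :
    ∃ q ∈ L, q < 1 ∧ ∀ k ≤ (christoffelPath L).length,
      ((((christoffelPath L).take k).count true : ℕ) : ℚ) - q * k <
        ((((christoffelPath L).take j).count true : ℕ) : ℚ) + 1 - q * (j + 1) := by
  induction L generalizing j with
  | nil => simp at hj
  | cons q L ih =>
    obtain ⟨hq, hs'⟩ := List.pairwise_cons.mp hs
    obtain ⟨h0, h1⟩ := hL q (by simp)
    rcases lt_or_ge j q.den with hjq | hjq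
    · have e := count_take_succ _ (show j < (christoffel q).length by simpa using hjq)
      have hE' : (christoffel q)[j]'(by simpa using hjq) = false := by
        rw [← hE]
        exact (List.getElem_append_left (by simpa using hjq)).symm
      rw [hE'] at e
      simp only [Bool.false_eq_true, if_false, add_zero] at e
      -- An east step keeps the count, so the right side of the goal is positive for this `q`, while
      -- the whole path stays weakly below the line of slope `q`.
      have h2 := lt_count_take_christoffel h0 h1 (show j + 1 ≤ q.den from hjq)
      rw [e] at h2
      refine ⟨q, by simp, ?_, fun k hk => ?_⟩
      · have h3 := count_take_christoffel_le h0 h1 hjq.le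
        by_contra h
        obtain rfl : q = 1 := le_antisymm h1 (not_lt.mp h)
        push_cast at h2
        linarith
      · have h3 : (((((christoffelPath (q :: L)).take k).count true : ℕ) : ℚ) : ℝ) ≤ (q * k : ℚ) := by
          push_cast
          refine count_take_christoffelPath_le hL (fun r hr => ?_) hk
          rcases List.mem_cons.mp hr with rfl | hr
          · exact le_rfl
          · exact_mod_cast hq r hr
        have h3 := Rat.cast_le.mp h3
        rw [christoffelPath_cons, List.take_append_of_le_length (i := j) (by simpa using hjq.le)]
        push_cast at h2
        rw [christoffelPath_cons] at h3
        linarith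
    · obtain ⟨i, rfl⟩ := Nat.exists_eq_add_of_le hjq
      have hE' : (christoffelPath L)[i]'(by simp at hj; omega) = false := by
        rw [← hE]
        simp [christoffelPath_cons, List.getElem_append_right]
      obtain ⟨p, hp, hp1, h⟩ := ih (fun r hr => hL r (by simp [hr])) hs' _ hE'
      have hc := count_christoffel_rat h0 h1
      have ea : ∀ k, (((christoffelPath (q :: L)).take (q.den + k)).count true : ℕ) =
          (christoffel q).count true + ((christoffelPath L).take k).count true := fun k => by
        have := count_take_append (christoffel q) (christoffelPath L) k
        rwa [length_christoffel] at this
      refine ⟨p, by simp [hp], hp1, fun k hk => ?_⟩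
      rw [ea]
      push_cast
      rw [hc]
      -- As `p ≤ q`, points of the first word are no higher, relative to slope `p`, than its end; `h
      -- 0` puts that end below the bound.
      rcases le_or_gt k q.den with hk' | hk'
      · rw [christoffelPath_cons, List.take_append_of_le_length (by simpa using hk')]
        have h3 := count_take_christoffel_le h0 h1 hk'
        have h4 := h 0 (by simp)
        have h5 : p ≤ q := hq p hp
        have h6 : (k : ℚ) ≤ q.den := by exact_mod_cast hk'
        simp at h4
        nlinarith
      · obtain ⟨l, rfl⟩ := Nat.exists_eq_add_of_le hk'.le
        rw [ea]
        have := h l (by simp at hk; omega)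
        push_cast
        rw [hc]
        linarith

/-- No unit cell lies between the path and its upper convex hull. -/
def NoCellInHull (w : List Bool) : Prop :=
  ∀ a b : ℤ, CellAbovePath w a b → ¬ (unitCell a b ⊆ pathHull w)

theorem pathHull_subset_of_forall_le {w : List Bool} {s t c : ℝ}
    (h : ∀ k ≤ w.length, s * (pathPoint w k).1 + t * (pathPoint w k).2 ≤ c) {z : ℝ × ℝ}
    (hz : z ∈ pathHull w) : s * z.1 + t * z.2 ≤ c := by
  have hconv : Convex ℝ {z : ℝ × ℝ | s * z.1 + t * z.2 ≤ c} :=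
    convex_halfSpace_le (f := fun z : ℝ × ℝ => s * z.1 + t * z.2)
      ⟨fun x y => by simp; ring, fun r x => by simp; ring⟩ c
  refine convexHull_min ?_ hconv hz
  rintro _ ⟨k, rfl⟩
  rcases le_total k w.length with hk | hk
  · exact h k hk
  · rw [pathPoint_of_length_le _ hk]; exact h _ le_rfl

theorem pathPoint_mem_pathHull (w : List Bool) (k : ℕ) : pathPoint w k ∈ pathHull w :=
  subset_convexHull ℝ _ ⟨k, rfl⟩

/-- Below a cell above the path, in the same column, the path makes an east step. -/
theorem exists_east_step {w : List Bool} {a b : ℕ} {i : ℕ}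
    (h1 : a + 1 ≤ (w.take i).count false) (h2 : (w.take i).count true ≤ b) :
    ∃ j, ∃ hj : j < w.length, w[j] = false ∧ (w.take j).count false = a ∧
      (w.take j).count true ≤ b := by
  have hex : ∃ i, a + 1 ≤ (w.take i).count false := ⟨i, h1⟩
  classical
  have hs := Nat.find_spec hex
  have hle := Nat.find_min' hex h1
  obtain ⟨j, hj⟩ : ∃ j, Nat.find hex = j + 1 :=
    Nat.exists_eq_succ_of_ne_zero (fun h0 => by rw [h0] at hs; simp at hs)
  have hm := Nat.find_min hex (show j < Nat.find hex by omega)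
  rw [hj] at hs hle
  have hjl : j < w.length := by
    by_contra hcon
    rw [List.take_of_length_le (by omega)] at hs hm
    exact hm hs
  rw [List.take_succ_eq_append_getElem hjl, List.count_append] at hs
  refine ⟨j, hjl, ?_, ?_, ?_⟩
  · by_contra h
    simp only [Bool.not_eq_false] at h
    rw [h] at hs
    simp at hs
    omega
  · have : [w[j]].count false ≤ 1 := by simpa using List.count_le_length (a := false) (l := [w[j]])
    omega
  · exact ((List.take_sublist_take_left (by omega : j ≤ i)).count_le true).trans h2

/-- The upper left corner of the cell lies at or above the point one unit north of the start of an
east step, hence strictly above a supporting line. Moving north increases `Y - q * (X + Y)` because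
`q < 1`. -/
theorem noCellInHull_christoffelPath {L : List ℚ} (hL : ∀ q ∈ L, 0 ≤ q ∧ q ≤ 1)
    (hs : L.Pairwise (· ≥ ·)) : NoCellInHull (christoffelPath L) := by
  rintro a b ⟨i, h1, h2⟩ hsub
  set w := christoffelPath L with hw
  have hz : ((a : ℝ), (b : ℝ) + 1) ∈ pathHull w :=
    hsub ⟨⟨le_rfl, by simp⟩, ⟨by simp, le_rfl⟩⟩
  have ha : 0 ≤ a := by
    have := pathHull_subset_of_forall_le (s := -1) (t := 0) (c := 0) (w := w)
      (fun k _ => by simp [pathPoint]) hz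
    simp at this
    exact_mod_cast this
  have hb : 0 ≤ b := by
    have : (0 : ℝ) ≤ b := le_trans (by simp [pathPoint]) h2
    exact_mod_cast this
  lift a to ℕ using ha
  lift b to ℕ using hb
  obtain ⟨j, hj, hE, hja, hjb⟩ := exists_east_step (w := w) (a := a) (b := b) (i := i)
    (by simp only [pathPoint] at h1; exact_mod_cast h1)
    (by simp only [pathPoint] at h2; exact_mod_cast h2)
  obtain ⟨q, -, hq1, hq⟩ := exists_support_of_east_step hL hs hj hE
  have hq1' : (q : ℝ) < 1 := by exact_mod_cast hq1
  set T := (w.take j).count true with hT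
  have hja' : ((a : ℕ) : ℝ) = j - (T : ℝ) := by rw [← hja, count_false_take _ _ hj.le]
  have hq' : ∀ k ≤ w.length, (((w.take k).count true : ℕ) : ℝ) - q * k < (T : ℝ) + 1 - q * (j + 1) :=
    fun k hk => by exact_mod_cast hq k hk
  -- The half-plane used for the hull is closed, so the strict bounds are replaced by the attained
  -- maximum.
  obtain ⟨k, hk, hmax⟩ := Finset.exists_max_image (Finset.range (w.length + 1))
    (fun k => (((w.take k).count true : ℕ) : ℝ) - q * k) ⟨0, by simp⟩
  have hk' := hq' k (by simp at hk; omega)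
  have := pathHull_subset_of_forall_le (s := -q) (t := 1 - q)
    (c := (((w.take k).count true : ℕ) : ℝ) - q * k) (w := w)
      (fun l hl => by
        have := hmax l (by simp; omega)
        rw [pathPoint_eq _ hl]
        linarith) hz
  have hTb : (T : ℝ) ≤ b := by exact_mod_cast hjb
  simp only [Int.cast_natCast] at this
  rw [hja'] at this
  nlinarith

/-! ### Factorization into Christoffel words -/

/-- Translation by the end point of `u` sends cells to cells and the hull of `v` into the hull of `u
++ v`. This permits recursion on suffixes, which need not begin with a north step. -/
theorem NoCellInHull.of_append {u v : List Bool} (h : NoCellInHull (u ++ v)) : NoCellInHull v := by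
  rintro a b ⟨i, h1, h2⟩ hsub
  have hp : pathPoint u u.length = (((u.count false : ℕ) : ℝ), ((u.count true : ℕ) : ℝ)) := by
    simp [pathPoint]
  refine h (a + (u.count false : ℕ)) (b + (u.count true : ℕ)) ⟨u.length + i, ?_, ?_⟩ ?_
  · rw [pathPoint_append_add, hp]; push_cast; simp only [Prod.fst_add]; linarith
  · rw [pathPoint_append_add, hp]; push_cast; simp only [Prod.snd_add]; linarith
  · rintro z ⟨⟨hz1, hz2⟩, ⟨hz3, hz4⟩⟩
    push_cast at hz1 hz2 hz3 hz4
    have hz : z - pathPoint u u.length ∈ pathHull v := by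
      refine hsub ⟨⟨?_, ?_⟩, ⟨?_, ?_⟩⟩ <;> rw [hp] <;> simp <;> linarith
    have hconv : Convex ℝ ((fun y => pathPoint u u.length + y) ⁻¹' pathHull (u ++ v)) :=
      (convex_convexHull ℝ _).translate_preimage_right _
    have : pathHull v ⊆ (fun y => pathPoint u u.length + y) ⁻¹' pathHull (u ++ v) := by
      refine convexHull_min ?_ hconv
      rintro _ ⟨k, rfl⟩
      simp only [Set.mem_preimage, ← pathPoint_append_add]
      exact pathPoint_mem_pathHull _ _
    simpa using this hz

theorem unitCell_subset_of_corners {a b : ℤ} {S : Set (ℝ × ℝ)} (hS : Convex ℝ S)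
    (h1 : ((a : ℝ), (b : ℝ)) ∈ S) (h2 : ((a : ℝ) + 1, (b : ℝ)) ∈ S)
    (h3 : ((a : ℝ), (b : ℝ) + 1) ∈ S) (h4 : ((a : ℝ) + 1, (b : ℝ) + 1) ∈ S) :
    unitCell a b ⊆ S := by
  rw [unitCell, ← segment_eq_Icc (by linarith), ← segment_eq_Icc (by linarith),
    ← convexHull_pair, ← convexHull_pair, ← convexHull_prod]
  refine convexHull_min ?_ hS
  rintro ⟨x, y⟩ ⟨hx, hy⟩
  simp only [Set.mem_insert_iff, Set.mem_singleton_iff] at hx hy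
  rcases hx with rfl | rfl <;> rcases hy with rfl | rfl <;> assumption

/-- Points between the path and one of its chords from the origin are in the convex hull. -/
theorem mem_pathHull_of_le_chord {w : List Bool} {q : ℝ} {n : ℕ} (hn : n ≤ w.length)
    (hq : (((w.take n).count true : ℕ) : ℝ) = q * n) {k : ℕ} (hk : k ≤ n) {y : ℝ}
    (h1 : (((w.take k).count true : ℕ) : ℝ) ≤ y) (h2 : y ≤ q * k) :
    ((k : ℝ) - y, y) ∈ pathHull w := by
  have hconv : Convex ℝ (pathHull w) := convex_convexHull ℝ _
  -- On the antidiagonal `X + Y = k` the chord has height `q * k`; the required point lies between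
  -- it and the path point.
  have hchord : ((k : ℝ) - q * k, q * k) ∈ pathHull w := by
    rcases Nat.eq_zero_or_pos n with rfl | hpos
    · obtain rfl : k = 0 := by omega
      simpa [pathPoint] using pathPoint_mem_pathHull w 0
    · have hn0 : (0 : ℝ) < n := by exact_mod_cast hpos
      have hkn : (k : ℝ) ≤ n := by exact_mod_cast hk
      have := hconv (pathPoint_mem_pathHull w 0) (pathPoint_mem_pathHull w n)
        (a := 1 - k / n) (b := k / n) (by rw [sub_nonneg, div_le_one hn0]; exact hkn)
        (by positivity) (by ring)
      rw [pathPoint_eq w hn, hq] at this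
      convert this using 1
      ext <;> simp [pathPoint] <;> field_simp
  have hp := pathPoint_mem_pathHull w k
  rw [pathPoint_eq w (hk.trans hn)] at hp
  set t := (((w.take k).count true : ℕ) : ℝ) with ht
  rcases (h1.trans h2).eq_or_lt with h | h
  · have : y = q * k := le_antisymm h2 (h ▸ h1)
    rw [this]; exact hchord
  · have hd : 0 < q * k - t := sub_pos.mpr h
    have hd' : (k : ℝ) * q - t ≠ 0 := by rw [mul_comm]; exact hd.ne'
    have := hconv hp hchord (a := (q * k - y) / (q * k - t)) (b := (y - t) / (q * k - t))
      (div_nonneg (by linarith) hd.le) (div_nonneg (by linarith) hd.le)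
      (by rw [← add_div, div_eq_one_iff_eq hd.ne']; ring)
    convert this using 1
    ext <;> simp <;> field_simp <;> ring

/-- An initial part of a path without cells in its hull that ends on the steepest line through the
origin is a Christoffel path: it stays at distance less than one step below its chord. -/
theorem lt_count_take_of_noCellInHull {w : List Bool} (hw : NoCellInHull w) {q : ℝ} (hq1 : q ≤ 1)
    {n : ℕ} (hn : n ≤ w.length) (hq : (((w.take n).count true : ℕ) : ℝ) = q * n)
    (hle : ∀ k ≤ n, (((w.take k).count true : ℕ) : ℝ) ≤ q * k) {k : ℕ} (hk : k ≤ n) :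
    q * k < ((w.take k).count true : ℕ) + 1 := by
  induction k with
  | zero => simp
  | succ k ih =>
    have ih := ih (by omega)
    have e := count_take_succ w (show k < w.length by omega)
    cases hwk : w[k]
    · rw [hwk] at e
      simp only [Bool.false_eq_true, if_false, add_zero] at e
      rw [e]
      by_contra hcon
      rw [not_lt] at hcon
      set T := (w.take k).count true with hT
      have hX : (w.take k).count false + T = k := by
        have := List.count_false_add_count_true (w.take k)
        rwa [List.length_take, min_eq_left (by omega)] at this
      set X := (w.take k).count false with hX'
      have hXr : (k : ℝ) = X + T := by exact_mod_cast hX.symm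
      have hk2 : k + 2 ≤ n := by
        by_contra h
        obtain rfl : n = k + 1 := by omega
        rw [e] at hq
        linarith
      have e2 := count_take_succ w (show k + 1 < w.length by omega)
      have e3 : (w.take (k + 1 + 1)).count true ≤ T + 1 := by
        rw [e2, e]; split_ifs <;> omega
      have e3' : (((w.take (k + 1 + 1)).count true : ℕ) : ℝ) ≤ T + 1 := by exact_mod_cast e3
      have hq0 : 0 ≤ q := by
        by_contra h
        have : (0 : ℝ) < (k + 1 : ℕ) := by positivity
        have h2 : (0 : ℝ) ≤ T := by positivity
        nlinarith
      have hconv : Convex ℝ (pathHull w) := convex_convexHull ℝ _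
      -- This cell stands on the east step `k`: its lower corners are path points, its upper ones
      -- lie on the antidiagonals `k + 1` and `k + 2` between path and chord.
      refine hw X T ⟨k + 1, ?_, ?_⟩ (unitCell_subset_of_corners hconv ?_ ?_ ?_ ?_)
      · rw [pathPoint_eq w (by omega), e]; push_cast; linarith
      · rw [pathPoint_eq w (by omega), e]; push_cast; linarith
      · have := pathPoint_mem_pathHull w k
        rw [pathPoint_eq w (by omega), ← hT] at this
        convert this using 2 <;> push_cast <;> linarith
      · have := pathPoint_mem_pathHull w (k + 1)
        rw [pathPoint_eq w (by omega), e] at this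
        convert this using 2 <;> push_cast <;> linarith
      · have := mem_pathHull_of_le_chord hn hq (show k + 1 ≤ n by omega) (y := T + 1)
          (by rw [e]; linarith) hcon
        convert this using 2 <;> push_cast <;> linarith
      · have := mem_pathHull_of_le_chord hn hq hk2 (y := T + 1) e3'
          (by push_cast at hcon ⊢; linarith)
        convert this using 2 <;> push_cast <;> linarith
    · rw [hwk] at e
      simp only [if_true] at e
      rw [e]; push_cast; linarith

/-- The path starts with the Christoffel word of its steepest slope. -/
theorem exists_eq_christoffel_append {w : List Bool} (hw : NoCellInHull w) (hne : w ≠ []) :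
    ∃ q : ℚ, ∃ v, 0 ≤ q ∧ q ≤ 1 ∧ w = christoffel q ++ v ∧
      ∀ k ≤ w.length, (((w.take k).count true : ℕ) : ℚ) ≤ q * k := by
  have hlen : 1 ≤ w.length := List.length_pos_iff_ne_nil.mpr hne
  obtain ⟨m, hm, hmax⟩ := Finset.exists_max_image (Finset.Icc 1 w.length)
    (fun k => (((w.take k).count true : ℕ) : ℚ) / k) ⟨1, by simpa using hlen⟩
  rw [Finset.mem_Icc] at hm
  set q : ℚ := (((w.take m).count true : ℕ) : ℚ) / m with hqdef
  have hm0 : (0 : ℚ) < m := by exact_mod_cast hm.1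
  have h0 : 0 ≤ q := by positivity
  have h1 : q ≤ 1 := by
    rw [hqdef, div_le_one hm0]
    have := List.count_le_length (a := true) (l := w.take m)
    rw [List.length_take, min_eq_left hm.2] at this
    exact_mod_cast this
  have hle : ∀ k ≤ w.length, (((w.take k).count true : ℕ) : ℚ) ≤ q * k := by
    intro k hk
    rcases Nat.eq_zero_or_pos k with rfl | hk0
    · simp
    · have hk0' : (0 : ℚ) < k := by exact_mod_cast hk0
      rw [← div_le_iff₀ hk0']
      exact hmax k (by simp; omega)
  have hqm : (((w.take m).count true : ℕ) : ℚ) = q * m := by rw [hqdef]; field_simp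
  have hlt : ∀ k ≤ m, q * k < (((w.take k).count true : ℕ) : ℚ) + 1 := by
    intro k hk
    have := lt_count_take_of_noCellInHull hw (q := (q : ℝ)) (by exact_mod_cast h1) hm.2
      (by exact_mod_cast hqm) (fun k hk => by exact_mod_cast hle k (hk.trans hm.2)) hk
    exact_mod_cast this
  -- The steepest chord may contain several lattice points; only the first `q.den` letters are split
  -- off.
  have hdm : q.den ≤ m := by
    refine Nat.le_of_dvd hm.1 ?_
    have h2 : q = Rat.divInt ((w.take m).count true : ℕ) (m : ℤ) := by
      rw [hqdef, Rat.divInt_eq_div]; push_cast; rfl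
    have := Rat.den_dvd ((w.take m).count true : ℕ) (m : ℤ)
    rw [← h2] at this
    exact_mod_cast this
  refine ⟨q, w.drop q.den, h0, h1, ?_, hle⟩
  have : w.take q.den = christoffel q := by
    refine eq_of_count_take (by simp; omega) fun k hk => ?_
    rw [List.length_take, min_eq_left (by omega)] at hk
    rw [List.take_take, min_eq_left hk]
    have e := count_take_christoffel h0 h1 hk
    have e2 : ⌊q * k⌋ = (((w.take k).count true : ℕ) : ℤ) := by
      rw [Int.floor_eq_iff]
      exact ⟨by exact_mod_cast hle k (by omega), by exact_mod_cast hlt k (by omega)⟩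
    rw [e2] at e
    exact_mod_cast e.symm
  rw [← this, List.take_append_drop]

theorem exists_christoffelPath_eq (w : List Bool) (hw : NoCellInHull w) :
    ∃ L : List ℚ, (∀ q ∈ L, 0 ≤ q ∧ q ≤ 1) ∧ L.Pairwise (· ≥ ·) ∧ christoffelPath L = w := by
  induction hl : w.length using Nat.strong_induction_on generalizing w with
  | _ n ih =>
    by_cases hne : w = []
    · exact ⟨[], by simp, by simp, by simp [hne]⟩
    · obtain ⟨q, v, h0, h1, hqv, hle⟩ := exists_eq_christoffel_append hw hne
      have hvl : w.length = q.den + v.length := by rw [hqv]; simp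
      obtain ⟨L, hL, hs, rfl⟩ := ih v.length (by have := q.den_pos; omega) v
        (NoCellInHull.of_append (hqv ▸ hw)) rfl
      refine ⟨q :: L, ?_, ?_, by rw [hqv]; rfl⟩
      · intro p hp
        rcases List.mem_cons.mp hp with rfl | hp
        · exact ⟨h0, h1⟩
        · exact hL p hp
      · rw [← List.isChain_iff_pairwise] at hs ⊢
        cases L with
        | nil => simp
        | cons p L =>
          refine List.IsChain.cons_cons ?_ hs
          obtain ⟨hp0, hp1⟩ := hL p (by simp)
          -- The end of the second word is not above the line of slope `q` through the origin, so `p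
          -- ≤ q`.
          have h2 := hle (q.den + p.den) (by rw [hvl]; simp)
          have e := count_take_append (christoffel q) (christoffelPath (p :: L)) p.den
          rw [length_christoffel] at e
          rw [hqv, e, christoffelPath_cons, List.take_append_of_le_length (by simp),
            List.take_of_length_le (by simp)] at h2
          push_cast at h2
          rw [count_christoffel_rat h0 h1, count_christoffel_rat hp0 hp1] at h2
          have h3 : (0 : ℚ) < p.den := by exact_mod_cast p.den_pos
          have : p * p.den ≤ q * p.den := by linarith
          exact le_of_mul_le_mul_right this h3

/-! ### NW-convex paths as multisets of slopes -/

theorem head?_christoffelPath_cons {q : ℚ} (h1 : q ≤ 1) (L : List ℚ) :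
    (christoffelPath (q :: L)).head? = some true ↔ q = 1 := by
  obtain ⟨d, hd⟩ := Nat.exists_eq_succ_of_ne_zero q.den_ne_zero
  have : (christoffel q).head? = some (decide (1 ≤ q)) := by
    rw [christoffel, hd, List.range_succ_eq_map]
    simp [Int.floor_pos]
  rw [christoffelPath_cons, List.head?_append, this]
  simpa using ⟨fun h => le_antisymm h1 h, fun h => h.ge⟩

/-- The last letter tells whether `⌊q * j⌋` jumps on reaching the integer `q.num`, which happens
unless `q` is an integer multiple of nothing but zero steps: `q * (q.den - 1) < q.num` means `0 <
q`. -/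
theorem getLast?_christoffel (q : ℚ) :
    (christoffel q).getLast? = some true ↔ 0 < q := by
  obtain ⟨d, hd⟩ := Nat.exists_eq_succ_of_ne_zero q.den_ne_zero
  have : (christoffel q).getLast? = some (decide (⌊q * d⌋ < q.num)) := by
    rw [christoffel, hd, List.range_succ, List.map_append]
    have : q * (d + 1) = q.num := by
      rw [← Rat.mul_den_eq_num, hd]; push_cast; rfl
    simp [this]
  rw [this]
  simp only [Option.some.injEq, decide_eq_true_eq, Int.floor_lt]
  rw [← Rat.mul_den_eq_num, hd]
  push_cast
  constructor
  · intro h; linarith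
  · intro h; linarith

theorem getLast?_christoffelPath {L : List ℚ} (hL : ∀ q ∈ L, 0 ≤ q) (hs : L.Pairwise (· ≥ ·))
    (hne : L ≠ []) : (christoffelPath L).getLast? = some true ↔ ∀ q ∈ L, 0 < q := by
  obtain ⟨l, p, rfl⟩ : ∃ l p, L = l ++ [p] := ⟨_, _, (List.dropLast_append_getLast hne).symm⟩
  have h1 : (christoffelPath (l ++ [p])).getLast? = (christoffel p).getLast? := by
    rw [christoffelPath, List.flatMap_append, List.flatMap_singleton]
    exact List.getLast?_append_of_ne_nil _ (christoffel_ne_nil p)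
  rw [h1, getLast?_christoffel]
  refine ⟨fun h q hq => ?_, fun h => h p (by simp)⟩
  rcases List.mem_append.mp hq with hq | hq
  · exact h.trans_le ((List.pairwise_append.mp hs).2.2 q hq p (by simp))
  · rw [List.mem_singleton.mp hq]; exact h

/-- The multisets of rational numbers in `(0, 1]` whose denominators add up to `N`. -/
def slopeSet (N : ℕ) : Set (Multiset ℚ) :=
  {M | (∀ q ∈ M, 0 < q ∧ q ≤ 1) ∧ (M.map Rat.den).sum = N}

/-- The concatenation of the Christoffel words of a multiset of slopes, steepest slope first. -/
def convexPath (M : Multiset ℚ) : List Bool := christoffelPath (M.sort (· ≥ ·))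

theorem length_convexPath (M : Multiset ℚ) : (convexPath M).length = (M.map Rat.den).sum := by
  rw [convexPath, length_christoffelPath, ← Multiset.sum_coe, ← Multiset.map_coe,
    Multiset.sort_eq]

theorem convexPath_injective {M M' : Multiset ℚ} (hM : ∀ q ∈ M, 0 ≤ q ∧ q ≤ 1)
    (hM' : ∀ q ∈ M', 0 ≤ q ∧ q ≤ 1) (h : convexPath M = convexPath M') : M = M' := by
  have := christoffelPath_injective (fun q hq => hM q (by simpa using hq))
    (fun q hq => hM' q (by simpa using hq)) (Multiset.pairwise_sort _ _)
    (Multiset.pairwise_sort _ _) h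
  rw [← Multiset.sort_eq M (· ≥ ·), this, Multiset.sort_eq]

theorem convexPath_injOn (N : ℕ) : Set.InjOn convexPath (slopeSet N) := fun _ hM _ hM' h =>
  convexPath_injective (fun q hq => ⟨(hM.1 q hq).1.le, (hM.1 q hq).2⟩)
    (fun q hq => ⟨(hM'.1 q hq).1.le, (hM'.1 q hq).2⟩) h

theorem finite_slopeSet (N : ℕ) : (slopeSet N).Finite := by
  refine Set.Finite.of_injOn (t := {w : List Bool | w.length = N}) (fun M hM => ?_)
    (convexPath_injOn N) (List.finite_length_eq Bool N)
  simpa [length_convexPath] using hM.2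

/-- The finite set of multisets of slopes of total size `N`. -/
noncomputable def slopeFinset (N : ℕ) : Finset (Multiset ℚ) := (finite_slopeSet N).toFinset

theorem mem_slopeFinset {N : ℕ} {M : Multiset ℚ} :
    M ∈ slopeFinset N ↔ (∀ q ∈ M, 0 < q ∧ q ≤ 1) ∧ (M.map Rat.den).sum = N := by
  simp [slopeFinset, slopeSet]

theorem sort_one_cons {M : Multiset ℚ} (hM : ∀ q ∈ M, q ≤ 1) :
    (1 ::ₘ M).sort (· ≥ ·) = 1 :: M.sort (· ≥ ·) :=
  Multiset.sort_cons _ _ _ hM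

/-- The extra `1` is the mandatory first north step: being the largest slope, it is sorted to the
front. -/
theorem nwConvex_convexPath {M : Multiset ℚ} (hM : ∀ q ∈ M, 0 < q ∧ q ≤ 1) :
    NWConvex (convexPath (1 ::ₘ M)) := by
  have hL : ∀ q ∈ (1 ::ₘ M).sort (· ≥ ·), 0 < q ∧ q ≤ 1 := by
    intro q hq
    rw [Multiset.mem_sort, Multiset.mem_cons] at hq
    rcases hq with rfl | hq
    · norm_num
    · exact hM q hq
  have hs : ((1 ::ₘ M).sort (· ≥ ·)).Pairwise (· ≥ ·) := Multiset.pairwise_sort _ _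
  refine ⟨?_, ?_, noCellInHull_christoffelPath (fun q hq => ⟨(hL q hq).1.le, (hL q hq).2⟩) hs⟩
  · rw [convexPath, sort_one_cons fun q hq => (hM q hq).2, head?_christoffelPath_cons le_rfl]
  · rw [convexPath, getLast?_christoffelPath (fun q hq => (hL q hq).1.le) hs]
    · exact fun q hq => (hL q hq).1
    · rw [sort_one_cons fun q hq => (hM q hq).2]; simp

theorem exists_convexPath_eq {w : List Bool} (hw : NWConvex w) :
    ∃ M : Multiset ℚ, (∀ q ∈ M, 0 < q ∧ q ≤ 1) ∧ convexPath (1 ::ₘ M) = w := by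
  obtain ⟨h1, h2, h3⟩ := hw
  obtain ⟨L, hL, hs, rfl⟩ := exists_christoffelPath_eq w h3
  cases L with
  | nil => simp at h1
  | cons q L =>
    obtain rfl := (head?_christoffelPath_cons (hL q (by simp)).2 L).mp h1
    have hpos := (getLast?_christoffelPath (fun q hq => (hL q hq).1) hs (by simp)).mp h2
    refine ⟨(L : Multiset ℚ), fun q hq => ⟨hpos q ?_, (hL q ?_).2⟩, ?_⟩
    · exact List.mem_cons_of_mem _ (by simpa using hq)
    · exact List.mem_cons_of_mem _ (by simpa using hq)
    · rw [convexPath, Multiset.cons_coe, Multiset.coe_sort, List.mergeSort_eq_self]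
      simpa using hs

theorem mem_nwPaths {n : ℕ} {w : List Bool} : w ∈ nwPaths n ↔ w.length = n ∧ NWConvex w := by
  simp [nwPaths]

theorem sum_nwPaths_succ (N : ℕ) (g : List Bool → ℝ) :
    ∑ w ∈ nwPaths (N + 1), g w = ∑ M ∈ slopeFinset N, g (convexPath (1 ::ₘ M)) := by
  refine (Finset.sum_bij (fun M _ => convexPath (1 ::ₘ M)) (fun M hM => ?_)
    (fun M hM M' hM' h => ?_) (fun w hw => ?_) fun _ _ => rfl).symm
  · rw [mem_slopeFinset] at hM
    rw [mem_nwPaths]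
    refine ⟨?_, nwConvex_convexPath hM.1⟩
    rw [length_convexPath, Multiset.map_cons, Multiset.sum_cons, hM.2]
    simp [add_comm]
  · rw [mem_slopeFinset] at hM hM'
    have aux : ∀ M : Multiset ℚ, (∀ q ∈ M, 0 < q ∧ q ≤ 1) → ∀ q ∈ 1 ::ₘ M, 0 ≤ q ∧ q ≤ 1 := by
      intro M hM q hq
      rcases Multiset.mem_cons.mp hq with rfl | hq
      · norm_num
      · exact ⟨(hM q hq).1.le, (hM q hq).2⟩
    exact (Multiset.cons_inj_right 1).mp (convexPath_injective (aux M hM.1) (aux M' hM'.1) h)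
  · rw [mem_nwPaths] at hw
    obtain ⟨M, hM, rfl⟩ := exists_convexPath_eq hw.2
    refine ⟨M, mem_slopeFinset.mpr ⟨hM, ?_⟩, rfl⟩
    have := hw.1
    rw [length_convexPath, Multiset.map_cons, Multiset.sum_cons] at this
    simp at this
    omega

theorem card_nwPaths_succ (N : ℕ) : (nwPaths (N + 1)).card = (slopeFinset N).card := by
  have := sum_nwPaths_succ N fun _ => 1
  simpa using this

theorem slopePoint_convexPath {M : Multiset ℚ} (hM : ∀ q ∈ M, 0 < q ∧ q ≤ 1) {x : ℝ}
    (hx : 0 ≤ x) :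
    slopePoint (convexPath (1 ::ₘ M)) x =
      ((M.map fun q : ℚ => if x / (1 + x) < q then (q.den : ℝ) * (1 - q) else 0).sum,
       1 + (M.map fun q : ℚ => if x / (1 + x) < q then (q.den : ℝ) * q else 0).sum) := by
  have hM' : ∀ q ∈ 1 ::ₘ M, 0 ≤ q ∧ q ≤ 1 := by
    intro q hq
    rcases Multiset.mem_cons.mp hq with rfl | hq
    · norm_num
    · exact ⟨(hM q hq).1.le, (hM q hq).2⟩
  rw [convexPath, slopePoint_christoffelPath (fun q hq => hM' q (by simpa using hq))
    (Multiset.pairwise_sort _ _) hx]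
  have h1 : x / (1 + x) < ((1 : ℚ) : ℝ) := by
    rw [div_lt_iff₀ (by linarith)]; push_cast; linarith
  have e : ∀ f : ℚ → ℝ, (((1 ::ₘ M).sort (· ≥ ·)).map f).sum = f 1 + (M.map f).sum := by
    intro f
    rw [← Multiset.sum_coe, ← Multiset.map_coe, Multiset.sort_eq, Multiset.map_cons,
      Multiset.sum_cons]
  rw [e, e, if_pos h1, if_pos h1]
  simp

/-! ### Multiplicities of slopes -/

/-- The rational numbers in `(0, 1]` with denominator `d`. -/
def slopesOfDen (d : ℕ) : Finset ℚ :=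
  ((Finset.Icc 1 d).filter fun b => b.Coprime d).image fun b : ℕ => (b : ℚ) / d

theorem mem_slopesOfDen {d : ℕ} (hd : 0 < d) {q : ℚ} :
    q ∈ slopesOfDen d ↔ (0 < q ∧ q ≤ 1) ∧ q.den = d := by
  have hd0 : (0 : ℚ) < d := by exact_mod_cast hd
  simp only [slopesOfDen, Finset.mem_image, Finset.mem_filter, Finset.mem_Icc]
  constructor
  · rintro ⟨b, ⟨⟨h1, h2⟩, h3⟩, rfl⟩
    refine ⟨⟨by positivity, ?_⟩, ?_⟩
    · rw [div_le_one hd0]; exact_mod_cast h2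
    · have := Rat.den_div_eq_of_coprime (a := b) (b := d) (by exact_mod_cast hd) (by simpa using h3)
      rw [Int.cast_natCast, Int.cast_natCast] at this
      exact Int.natCast_inj.mp this
  · rintro ⟨⟨h1, h2⟩, rfl⟩
    have hnum : 0 < q.num := Rat.num_pos.mpr h1
    have hn : ((q.num.natAbs : ℕ) : ℤ) = q.num := Int.natAbs_of_nonneg hnum.le
    have hnq : ((q.num.natAbs : ℕ) : ℚ) = q.num := by rw [← hn]; simp
    refine ⟨q.num.natAbs, ⟨⟨by omega, ?_⟩, q.reduced⟩, ?_⟩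
    · rw [← Rat.num_div_den q, div_le_one hd0] at h2
      have : q.num ≤ q.den := by exact_mod_cast h2
      omega
    · rw [hnq, Rat.num_div_den]

/-- The total multiplicity of the slope `q` in all multisets of slopes of total size `N`. -/
noncomputable def totalCount (N : ℕ) (q : ℚ) : ℕ := ∑ M ∈ slopeFinset N, M.count q

theorem cons_mem_slopeFinset {N : ℕ} {M : Multiset ℚ} {q : ℚ} (hq : 0 < q ∧ q ≤ 1) :
    q ::ₘ M ∈ slopeFinset (N + q.den) ↔ M ∈ slopeFinset N := by
  rw [mem_slopeFinset, mem_slopeFinset, Multiset.map_cons, Multiset.sum_cons,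
    Multiset.forall_mem_cons]
  constructor
  · rintro ⟨⟨-, h⟩, h'⟩; exact ⟨h, by omega⟩
  · rintro ⟨h, h'⟩; exact ⟨⟨hq, h⟩, by omega⟩

/-- Adjoining one `q` is a bijection onto the larger multisets that contain `q`, and raises its
multiplicity by one. The recursion sees `q` only through `q.den`. -/
theorem totalCount_add_den {q : ℚ} (hq : 0 < q ∧ q ≤ 1) (N : ℕ) :
    totalCount (N + q.den) q = totalCount N q + (slopeFinset N).card := by
  rw [totalCount, totalCount, Finset.card_eq_sum_ones, ← Finset.sum_add_distrib]
  symm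
  refine Finset.sum_of_injOn (fun M => q ::ₘ M) (fun M _ M' _ h => (Multiset.cons_inj_right q).mp h)
    (fun M hM => (cons_mem_slopeFinset hq).mpr hM) (fun M hM hM' => ?_) (fun M _ => ?_)
  · rw [Multiset.count_eq_zero]
    intro hqM
    obtain ⟨M, rfl⟩ := Multiset.exists_cons_of_mem hqM
    exact hM' ⟨M, (cons_mem_slopeFinset hq).mp hM, rfl⟩
  · simp

theorem den_le_of_mem {N : ℕ} {M : Multiset ℚ} (hM : M ∈ slopeFinset N) {q : ℚ} (hq : q ∈ M) :
    q.den ≤ N := by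
  rw [← (mem_slopeFinset.mp hM).2]
  exact Multiset.le_sum_of_mem (Multiset.mem_map_of_mem _ hq)

theorem totalCount_of_lt_den {q : ℚ} {N : ℕ} (hN : N < q.den) : totalCount N q = 0 := by
  refine Finset.sum_eq_zero fun M hM => ?_
  rw [Multiset.count_eq_zero]
  exact fun h => absurd (den_le_of_mem hM h) (by omega)

/-- Slopes with the same denominator have the same total multiplicity. -/
theorem totalCount_eq_of_den_eq {p q : ℚ} (hp : 0 < p ∧ p ≤ 1) (hq : 0 < q ∧ q ≤ 1)
    (h : p.den = q.den) (N : ℕ) : totalCount N p = totalCount N q := by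
  induction N using Nat.strong_induction_on with
  | _ N ih =>
    rcases lt_or_ge N p.den with hN | hN
    · rw [totalCount_of_lt_den hN, totalCount_of_lt_den (h ▸ hN)]
    · obtain ⟨m, rfl⟩ := Nat.exists_eq_add_of_le' hN
      rw [totalCount_add_den hp, h, totalCount_add_den hq, ih m (by have := p.den_pos; omega)]

/-- Unrolling the recursion gives the cardinalities at `N - q.den`, `N - 2 * q.den`, ..., which are
distinct indices below `N`. -/
theorem totalCount_le {q : ℚ} (hq : 0 < q ∧ q ≤ 1) (N : ℕ) :
    totalCount N q ≤ ∑ j ∈ Finset.range N, (slopeFinset j).card := by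
  induction N using Nat.strong_induction_on with
  | _ N ih =>
    rcases lt_or_ge N q.den with hN | hN
    · rw [totalCount_of_lt_den hN]; exact Nat.zero_le _
    · obtain ⟨m, rfl⟩ := Nat.exists_eq_add_of_le' hN
      have hd := q.den_pos
      rw [totalCount_add_den hq]
      calc totalCount m q + (slopeFinset m).card
          ≤ ∑ j ∈ Finset.range m, (slopeFinset j).card + (slopeFinset m).card :=
            Nat.add_le_add_right (ih m (by omega)) _
        _ = ∑ j ∈ Finset.range (m + 1), (slopeFinset j).card := (Finset.sum_range_succ _ _).symm
        _ ≤ _ := Finset.sum_le_sum_of_subset (Finset.range_mono (by omega))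

theorem sum_map_slopeFinset (N : ℕ) (f : ℚ → ℝ) :
    ∑ M ∈ slopeFinset N, (M.map f).sum =
      ∑ d ∈ Finset.Icc 1 N, ∑ q ∈ slopesOfDen d, totalCount N q * f q := by
  have hdisj : Set.PairwiseDisjoint (↑(Finset.Icc 1 N)) slopesOfDen := by
    intro d hd e he hne
    simp only [Finset.coe_Icc, Set.mem_Icc] at hd he
    refine Finset.disjoint_left.mpr fun q hq hq' => hne ?_
    rw [← ((mem_slopesOfDen (by omega)).mp hq).2, ← ((mem_slopesOfDen (by omega)).mp hq').2]
  rw [← Finset.sum_biUnion hdisj]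
  have h1 : ∀ M ∈ slopeFinset N, (M.map f).sum =
      ∑ q ∈ (Finset.Icc 1 N).biUnion slopesOfDen, (M.count q : ℝ) * f q := by
    intro M hM
    rw [Finset.sum_multiset_map_count]
    simp only [nsmul_eq_mul]
    refine Finset.sum_subset (fun q hq => ?_) fun q _ hq => ?_
    · rw [Multiset.mem_toFinset] at hq
      rw [Finset.mem_biUnion]
      exact ⟨q.den, Finset.mem_Icc.mpr ⟨q.den_pos, den_le_of_mem hM hq⟩,
        (mem_slopesOfDen q.den_pos).mpr ⟨(mem_slopeFinset.mp hM).1 q hq, rfl⟩⟩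
    · rw [Multiset.mem_toFinset] at hq
      rw [Multiset.count_eq_zero_of_notMem hq]; simp
  rw [Finset.sum_congr rfl h1, Finset.sum_comm]
  refine Finset.sum_congr rfl fun q _ => ?_
  rw [totalCount, Nat.cast_sum, Finset.sum_mul]

theorem inv_mem_slopesOfDen {d : ℕ} (hd : 0 < d) : (1 / d : ℚ) ∈ slopesOfDen d := by
  rw [slopesOfDen, Finset.mem_image]
  exact ⟨1, by simp; omega, by simp⟩

theorem sum_den_slopeFinset (N : ℕ) :
    ∑ M ∈ slopeFinset N, (M.map fun q : ℚ => (q.den : ℝ)).sum = N * (slopeFinset N).card := by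
  have : ∀ M ∈ slopeFinset N, (M.map fun q : ℚ => (q.den : ℝ)).sum = N := by
    intro M hM
    conv_rhs => rw [← (mem_slopeFinset.mp hM).2, Nat.cast_multiset_sum]
    simp
  rw [Finset.sum_congr rfl this]
  simp [mul_comm]

/-- All slopes of denominator `d` have the multiplicity of the representative `1 / d`, which
therefore factors out. -/
theorem sum_den_mul_slopeFinset (N : ℕ) (f : ℚ → ℝ) :
    ∑ M ∈ slopeFinset N, (M.map fun q : ℚ => (q.den : ℝ) * f q).sum =
      ∑ d ∈ Finset.Icc 1 N, d * totalCount N (1 / d) * ∑ q ∈ slopesOfDen d, f q := by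
  rw [sum_map_slopeFinset]
  refine Finset.sum_congr rfl fun d hd => ?_
  have hd : 0 < d := (Finset.mem_Icc.mp hd).1
  rw [Finset.mul_sum]
  refine Finset.sum_congr rfl fun q hq => ?_
  have h1 := (mem_slopesOfDen hd).mp hq
  have h2 := (mem_slopesOfDen hd).mp (inv_mem_slopesOfDen hd)
  rw [totalCount_eq_of_den_eq h1.1 h2.1 (h1.2.trans h2.2.symm), h1.2]
  ring

/-! ### A fixed slope has negligible weight -/

theorem card_slopeFinset_mono : Monotone fun N => (slopeFinset N).card := by
  refine monotone_nat_of_le_succ fun N => ?_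
  exact Finset.card_le_card_of_injOn (fun M => 1 ::ₘ M)
    (fun M hM => (cons_mem_slopeFinset (q := 1) (by norm_num)).mpr hM)
    (fun M _ M' _ h => (Multiset.cons_inj_right 1).mp h)

theorem card_slopeFinset_pos (N : ℕ) : 0 < (slopeFinset N).card := by
  refine Finset.card_pos.mpr ⟨Multiset.replicate N 1, mem_slopeFinset.mpr ⟨fun q hq => ?_, ?_⟩⟩
  · rw [Multiset.eq_of_mem_replicate hq]; norm_num
  · simp

/-- Count the total size `N` of all multisets by denominators, keeping only the slope `1 / d` for
each `d` and only the last term of its recursion. -/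
theorem sum_mul_card_slopeFinset_le (N : ℕ) :
    ∑ d ∈ Finset.Icc 1 N, (d : ℝ) * (slopeFinset (N - d)).card ≤ N * (slopeFinset N).card := by
  have h := sum_den_mul_slopeFinset N fun _ => 1
  simp only [mul_one, Finset.sum_const, nsmul_eq_mul] at h
  rw [sum_den_slopeFinset] at h
  rw [h]
  refine Finset.sum_le_sum fun d hd => ?_
  obtain ⟨hd, hdN⟩ := Finset.mem_Icc.mp hd
  have h1 : (1 : ℝ) ≤ (slopesOfDen d).card := by
    exact_mod_cast Finset.card_pos.mpr ⟨_, inv_mem_slopesOfDen hd⟩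
  have h2 : ((slopeFinset (N - d)).card : ℝ) ≤ totalCount N (1 / d) := by
    have h3 := (mem_slopesOfDen hd).mp (inv_mem_slopesOfDen hd)
    have h4 := totalCount_add_den h3.1 (N - d)
    rw [h3.2, Nat.sub_add_cancel hdN] at h4
    exact_mod_cast h4 ▸ Nat.le_add_left _ _
  calc (d : ℝ) * (slopeFinset (N - d)).card ≤ d * totalCount N (1 / d) := by gcongr
    _ ≤ _ := le_mul_of_one_le_right (by positivity) h1

/-- With `d = N - j`, terms with `d < D` are bounded by monotonicity, the others by `d / D` times
themselves. -/
theorem sum_card_slopeFinset_le (N : ℕ) {D : ℕ} (hD : 0 < D) :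
    ∑ j ∈ Finset.range N, ((slopeFinset j).card : ℝ) ≤
      D * (slopeFinset N).card + N * (slopeFinset N).card / D := by
  have hD0 : (0 : ℝ) < D := by exact_mod_cast hD
  have e : ∑ j ∈ Finset.range N, ((slopeFinset j).card : ℝ) =
      ∑ d ∈ Finset.Icc 1 N, ((slopeFinset (N - d)).card : ℝ) := by
    refine Finset.sum_bij' (fun j _ => N - j) (fun d _ => N - d) ?_ ?_ ?_ ?_ ?_ <;>
      intro a ha <;> simp only [Finset.mem_range, Finset.mem_Icc] at ha ⊢ <;> try omega
    congr 3; omega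
  have h1 : ∀ d ∈ Finset.Icc 1 N, ((slopeFinset (N - d)).card : ℝ) ≤
      (if d < D then ((slopeFinset N).card : ℝ) else 0) + d * (slopeFinset (N - d)).card / D := by
    intro d _
    split_ifs with h
    · have : ((slopeFinset (N - d)).card : ℝ) ≤ (slopeFinset N).card := by
        exact_mod_cast card_slopeFinset_mono (Nat.sub_le N d)
      have : (0 : ℝ) ≤ d * (slopeFinset (N - d)).card / D := by positivity
      linarith
    · rw [zero_add, le_div_iff₀ hD0, mul_comm]
      have : (D : ℝ) ≤ d := by exact_mod_cast not_lt.mp h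
      gcongr
  rw [e]
  refine (Finset.sum_le_sum h1).trans ?_
  rw [Finset.sum_add_distrib, ← Finset.sum_div]
  refine add_le_add ?_ (by gcongr; exact sum_mul_card_slopeFinset_le N)
  rw [← Finset.sum_filter, Finset.sum_const, nsmul_eq_mul]
  have : ((Finset.Icc 1 N).filter (· < D)).card ≤ D := by
    calc _ ≤ (Finset.range D).card := Finset.card_le_card fun d hd => by simp at hd ⊢; omega
      _ = D := Finset.card_range D
  gcongr

theorem tendsto_sum_card_slopeFinset_div :
    Tendsto (fun N : ℕ => (∑ j ∈ Finset.range N, ((slopeFinset j).card : ℝ)) /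
      (N * (slopeFinset N).card)) atTop (𝓝 0) := by
  rw [Metric.tendsto_atTop]
  intro ε hε
  obtain ⟨D, hD⟩ := exists_nat_gt (2 / ε)
  have hD0 : (0 : ℝ) < D := lt_trans (by positivity) hD
  obtain ⟨N₀, hN₀⟩ := exists_nat_gt (2 * D / ε)
  refine ⟨N₀, fun N hN => ?_⟩
  have hN' : 2 * D / ε < N := hN₀.trans_le (by exact_mod_cast hN)
  have hN0 : (0 : ℝ) < N := lt_trans (by positivity) hN'
  have hr : (0 : ℝ) < (slopeFinset N).card := by exact_mod_cast card_slopeFinset_pos N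
  rw [Real.dist_eq, sub_zero, abs_of_nonneg (by positivity), div_lt_iff₀ (by positivity)]
  refine (sum_card_slopeFinset_le N (by exact_mod_cast hD0)).trans_lt ?_
  rw [div_lt_iff₀ hε] at hD hN'
  have h1 : N * ((slopeFinset N).card : ℝ) / D < N * (slopeFinset N).card * (ε / 2) := by
    rw [div_lt_iff₀ hD0, mul_assoc]
    exact lt_mul_of_one_lt_right (by positivity) (by linarith)
  have h2 : (D : ℝ) * (slopeFinset N).card < N * (slopeFinset N).card * (ε / 2) := by
    have := mul_lt_mul_of_pos_right hN' hr
    linarith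
  linarith

/-- If the average of `f` over the slopes of denominator `d` is eventually within `ε` of `c`, then
so is, up to an error of lower order, the average of `f` over multisets of slopes. -/
theorem exists_abs_sum_slopeFinset_sub_le {f : ℚ → ℝ} {c ε : ℝ} (hε : 0 < ε) {D : ℕ}
    (hD : ∀ d ≥ D,
      |∑ q ∈ slopesOfDen d, f q - c * (slopesOfDen d).card| ≤ ε * (slopesOfDen d).card) :
    ∃ C : ℝ, 0 ≤ C ∧ ∀ N : ℕ,
      |∑ M ∈ slopeFinset N, (M.map fun q : ℚ => (q.den : ℝ) * f q).sum -
        c * (N * (slopeFinset N).card)| ≤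
      ε * (N * (slopeFinset N).card) + C * ∑ j ∈ Finset.range N, ((slopeFinset j).card : ℝ) := by
  obtain ⟨G, hG⟩ : ∃ G : ℕ → ℝ,
      ∀ d, G d = ∑ q ∈ slopesOfDen d, f q - c * (slopesOfDen d).card := ⟨_, fun _ => rfl⟩
  -- Only denominators below `D` escape the hypothesis; each contributes at most `d * |G d|` times
  -- the bound `S` on its multiplicity.
  refine ⟨∑ d ∈ Finset.range D, d * |G d|, by positivity, fun N => ?_⟩
  obtain ⟨S, hS⟩ : ∃ S : ℝ, S = ∑ j ∈ Finset.range N, ((slopeFinset j).card : ℝ) := ⟨_, rfl⟩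
  have hS0 : 0 ≤ S := by rw [hS]; positivity
  rw [← hS]
  have h1 : (N : ℝ) * (slopeFinset N).card =
      ∑ d ∈ Finset.Icc 1 N, (d : ℝ) * totalCount N (1 / d) * (slopesOfDen d).card := by
    have h := sum_den_mul_slopeFinset N fun _ => 1
    simp only [mul_one, Finset.sum_const, nsmul_eq_mul] at h
    rw [← h, sum_den_slopeFinset]
  have h2 : ∑ M ∈ slopeFinset N, (M.map fun q : ℚ => (q.den : ℝ) * f q).sum -
      c * (N * (slopeFinset N).card) =
      ∑ d ∈ Finset.Icc 1 N, (d : ℝ) * totalCount N (1 / d) * G d := by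
    rw [sum_den_mul_slopeFinset, h1, Finset.mul_sum, ← Finset.sum_sub_distrib]
    exact Finset.sum_congr rfl fun d _ => by rw [hG]; ring
  have h3 : ∀ d ∈ Finset.Icc 1 N, |(d : ℝ) * totalCount N (1 / d) * G d| ≤
      ε * (d * totalCount N (1 / d) * (slopesOfDen d).card) +
        if d < D then d * |G d| * S else 0 := by
    intro d hd
    have hd0 := (Finset.mem_Icc.mp hd).1
    have ht : (totalCount N (1 / d) : ℝ) ≤ S := by
      have := totalCount_le ((mem_slopesOfDen hd0).mp (inv_mem_slopesOfDen hd0)).1 N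
      rw [hS]
      exact_mod_cast this
    rw [abs_mul, abs_of_nonneg (by positivity : (0 : ℝ) ≤ d * totalCount N (1 / d))]
    split_ifs with h
    · have : (0 : ℝ) ≤ ε * (d * totalCount N (1 / d) * (slopesOfDen d).card) := by positivity
      have : (d : ℝ) * totalCount N (1 / d) * |G d| ≤ d * S * |G d| := by gcongr
      linarith
    · have := hD d (not_lt.mp h)
      rw [← hG] at this
      calc (d : ℝ) * totalCount N (1 / d) * |G d|
          ≤ d * totalCount N (1 / d) * (ε * (slopesOfDen d).card) := by gcongr
        _ = _ := by ring
  have h4 : ∑ d ∈ Finset.Icc 1 N, (if d < D then d * |G d| * S else 0) ≤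
      (∑ d ∈ Finset.range D, d * |G d|) * S := by
    rw [Finset.sum_mul, ← Finset.sum_filter]
    refine Finset.sum_le_sum_of_subset_of_nonneg (fun d hd => ?_) fun d _ _ => by positivity
    exact Finset.mem_range.mpr (Finset.mem_filter.mp hd).2
  have h5 := (Finset.abs_sum_le_sum_abs _ _).trans (Finset.sum_le_sum h3)
  rw [Finset.sum_add_distrib, ← Finset.mul_sum, ← h1, ← h2] at h5
  linarith

/-- If the average of `f` over the slopes of denominator `d` tends to `c`, then so does the average
of `f` over a random multiset of slopes, weighted by denominators. -/
theorem tendsto_mean_slopeFinset {f : ℚ → ℝ} {c : ℝ}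
    (hf : ∀ ε > 0, ∃ D : ℕ, ∀ d ≥ D,
      |∑ q ∈ slopesOfDen d, f q - c * (slopesOfDen d).card| ≤ ε * (slopesOfDen d).card) :
    Tendsto (fun N : ℕ => (∑ M ∈ slopeFinset N, (M.map fun q : ℚ => (q.den : ℝ) * f q).sum) /
      (N * (slopeFinset N).card)) atTop (𝓝 c) := by
  rw [Metric.tendsto_atTop]
  intro ε hε
  obtain ⟨D, hD⟩ := hf (ε / 2) (by positivity)
  obtain ⟨C, hC, hb⟩ := exists_abs_sum_slopeFinset_sub_le (by positivity) hD
  have ht := tendsto_sum_card_slopeFinset_div.const_mul C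
  rw [mul_zero] at ht
  obtain ⟨N₀, hN₀⟩ := (Metric.tendsto_atTop.mp ht) (ε / 2) (by positivity)
  refine ⟨max N₀ 1, fun N hN => ?_⟩
  have hN1 : (0 : ℝ) < N := by exact_mod_cast (le_max_right N₀ 1).trans hN
  have hr : (0 : ℝ) < (slopeFinset N).card := by exact_mod_cast card_slopeFinset_pos N
  have hp := mul_pos hN1 hr
  have h0 := hN₀ N ((le_max_left N₀ 1).trans hN)
  rw [Real.dist_eq, sub_zero] at h0
  have h1 := (abs_lt.mp h0).2
  rw [← mul_div_assoc, div_lt_iff₀ hp] at h1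
  rw [Real.dist_eq, div_sub' hp.ne', abs_div, abs_of_pos hp, div_lt_iff₀ hp, mul_comm _ c]
  linarith [hb N]

/-! ### Squarefree divisors against the totient -/

theorem card_squarefree_divisors_le {n : ℕ} (hn : n ≠ 0) :
    (n.divisors.filter Squarefree).card ≤ 2 ^ n.primeFactors.card := by
  rw [← Finset.card_powerset]
  refine Finset.card_le_card_of_injOn Nat.primeFactors (fun d hd => ?_) fun d hd e he h => ?_
  · rw [Finset.mem_coe, Finset.mem_filter, Nat.mem_divisors] at hd
    exact Finset.mem_coe.mpr (Finset.mem_powerset.mpr (Nat.primeFactors_mono hd.1.1 hn))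
  · rw [Finset.mem_coe, Finset.mem_filter] at hd he
    rw [← Nat.prod_primeFactors_of_squarefree hd.2, h, Nat.prod_primeFactors_of_squarefree he.2]

/-- The totient function dominates `n ^ (1 / 4) * 2 ^ ω n`. -/
theorem mul_pow_card_primeFactors_le_totient {n : ℕ} (hn : n ≠ 0) :
    n * 16 ^ n.primeFactors.card ≤ 96 * n.totient ^ 4 := by
  -- Least constants with `16 * p ≤ c p * (p - 1) ^ 4` at `p = 2` and `p = 3`; from `p = 5` on, `1`
  -- suffices. Their product is `96`.
  let c : ℕ → ℕ := fun p => if p = 2 then 32 else if p = 3 then 3 else 1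
  have hc1 : ∀ p, 1 ≤ c p := fun p => by simp only [c]; split_ifs <;> norm_num
  have hc : ∏ p ∈ n.primeFactors, c p ≤ 96 := by
    calc ∏ p ∈ n.primeFactors, c p ≤ ∏ p ∈ n.primeFactors ∪ {2, 3}, c p :=
          Finset.prod_le_prod_of_subset_of_one_le' Finset.subset_union_left fun p _ _ => hc1 p
      _ = ∏ p ∈ ({2, 3} : Finset ℕ), c p := by
          refine (Finset.prod_subset Finset.subset_union_right fun p _ hp => ?_).symm
          simp only [Finset.mem_insert, Finset.mem_singleton, not_or] at hp
          simp [c, hp]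
      _ = 96 := by simp [c]
  have hp : ∀ p ∈ n.primeFactors, p ^ n.factorization p * 16 ≤
      c p * (p ^ (n.factorization p - 1) * (p - 1)) ^ 4 := by
    intro p hp
    have hpp := Nat.prime_of_mem_primeFactors hp
    have hk : n.factorization p ≠ 0 := Finsupp.mem_support_iff.mp hp
    obtain ⟨k, hk⟩ := Nat.exists_eq_succ_of_ne_zero hk
    have h1 : p * 16 ≤ c p * (p - 1) ^ 4 := by
      simp only [c]
      split_ifs with h2 h3
      · subst h2; norm_num
      · subst h3; norm_num
      · have h5 : 5 ≤ p := by
          have := hpp.two_le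
          have h4 : p ≠ 4 := by rintro rfl; norm_num at hpp
          omega
        obtain ⟨m, rfl⟩ := Nat.exists_eq_add_of_le' h5
        have e : m + 5 - 1 = m + 4 := rfl
        rw [e]
        nlinarith [Nat.zero_le (m ^ 4), Nat.zero_le (m ^ 3), Nat.zero_le (m ^ 2)]
    have h2 : p ^ k ≤ (p ^ k) ^ 4 := Nat.le_self_pow (by norm_num) _
    rw [hk, Nat.succ_eq_add_one, Nat.add_sub_cancel, pow_succ, mul_pow, mul_assoc]
    calc p ^ k * (p * 16) ≤ (p ^ k) ^ 4 * (c p * (p - 1) ^ 4) := Nat.mul_le_mul h2 h1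
      _ = _ := by ring
  have h1 : n * 16 ^ n.primeFactors.card = ∏ p ∈ n.primeFactors, p ^ n.factorization p * 16 := by
    rw [Finset.prod_mul_distrib, Finset.prod_const]
    congr 1
    exact (Nat.prod_factorization_pow_eq_self hn).symm
  rw [h1, Nat.totient_eq_prod_factorization hn]
  refine (Finset.prod_le_prod' hp).trans ?_
  rw [Finset.prod_mul_distrib, Finset.prod_pow]
  exact Nat.mul_le_mul_right _ hc

/-- The number of squarefree divisors is negligible compared with the totient function. -/
theorem exists_two_pow_card_primeFactors_le {ε : ℝ} (hε : 0 < ε) :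
    ∃ D : ℕ, ∀ d ≥ D, (2 : ℝ) ^ d.primeFactors.card ≤ ε * d.totient := by
  obtain ⟨D, hD⟩ := exists_nat_gt (96 / ε ^ 4)
  refine ⟨D, fun d hd => ?_⟩
  have hd' : 96 / ε ^ 4 < d := hD.trans_le (by exact_mod_cast hd)
  have hd0 : (0 : ℝ) < d := lt_trans (by positivity) hd'
  rw [div_lt_iff₀ (by positivity)] at hd'
  have h : (d : ℝ) * 16 ^ d.primeFactors.card ≤ 96 * d.totient ^ 4 := by
    exact_mod_cast mul_pow_card_primeFactors_le_totient (n := d)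
      (by rintro rfl; simp at hd0)
  refine le_of_pow_le_pow_left₀ (n := 4) (by norm_num) (by positivity) ?_
  have e : ((2 : ℝ) ^ d.primeFactors.card) ^ 4 = 16 ^ d.primeFactors.card := by
    rw [← pow_mul, mul_comm, pow_mul]; norm_num
  rw [e]
  refine le_of_mul_le_mul_left (h.trans ?_) hd0
  calc (96 : ℝ) * d.totient ^ 4 ≤ (d * ε ^ 4) * d.totient ^ 4 := by gcongr
    _ = _ := by ring

/-! ### Equidistribution of reduced fractions -/

theorem card_slopesOfDen {d : ℕ} (hd : 0 < d) : (slopesOfDen d).card = d.totient := by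
  have hd0 : (d : ℚ) ≠ 0 := by exact_mod_cast hd.ne'
  rw [slopesOfDen, Finset.card_image_of_injective _ fun a b h => by
    simpa [div_left_inj' hd0] using h, ← Nat.filter_coprime_Ico_eq_totient d 1]
  congr 1
  ext b
  simp only [Finset.mem_filter, Finset.mem_Icc, Finset.mem_Ico, Nat.coprime_comm]
  constructor <;> rintro ⟨h1, h2⟩ <;> exact ⟨by omega, h2⟩

/-- Reducing `b / m` to lowest terms sorts these fractions by a denominator dividing `m`. -/
theorem sum_divisors_slopesOfDen {m : ℕ} (hm : 0 < m) (f : ℚ → ℝ) :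
    ∑ e ∈ m.divisors, ∑ q ∈ slopesOfDen e, f q = ∑ b ∈ Finset.Icc 1 m, f (b / m) := by
  have hm0 : (0 : ℚ) < m := by exact_mod_cast hm
  have hdisj : Set.PairwiseDisjoint (↑m.divisors) slopesOfDen := by
    intro d hd e he hne
    refine Finset.disjoint_left.mpr fun q hq hq' => hne ?_
    rw [← ((mem_slopesOfDen (Nat.pos_of_mem_divisors hd)).mp hq).2,
      ← ((mem_slopesOfDen (Nat.pos_of_mem_divisors he)).mp hq').2]
  rw [← Finset.sum_biUnion hdisj]
  symm
  refine Finset.sum_bij (fun (b : ℕ) _ => (b : ℚ) / m) (fun b hb => ?_) (fun a _ b _ h => ?_)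
    (fun q hq => ?_) fun _ _ => rfl
  · rw [Finset.mem_Icc] at hb
    have hb0 : (0 : ℚ) < b := by exact_mod_cast hb.1
    have hden : ((b : ℚ) / m).den ∣ m := by
      have := Rat.den_dvd (b : ℤ) (m : ℤ)
      rw [Rat.divInt_eq_div, Int.cast_natCast, Int.cast_natCast] at this
      exact_mod_cast this
    rw [Finset.mem_biUnion]
    refine ⟨_, Nat.mem_divisors.mpr ⟨hden, hm.ne'⟩, (mem_slopesOfDen (Rat.den_pos _)).mpr
      ⟨⟨by positivity, ?_⟩, rfl⟩⟩
    rw [div_le_one hm0]; exact_mod_cast hb.2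
  · rw [div_left_inj' hm0.ne'] at h
    exact_mod_cast h
  · rw [Finset.mem_biUnion] at hq
    obtain ⟨e, he, hq⟩ := hq
    obtain ⟨⟨h0, h1⟩, rfl⟩ := (mem_slopesOfDen (Nat.pos_of_mem_divisors he)).mp hq
    obtain ⟨k, hk⟩ := (Nat.mem_divisors.mp he).1
    have hnum : 0 < q.num := Rat.num_pos.mpr h0
    have hn : ((q.num.natAbs : ℕ) : ℤ) = q.num := Int.natAbs_of_nonneg hnum.le
    have hnq : ((q.num.natAbs : ℕ) : ℚ) = q.num := by rw [← hn]; simp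
    have hq' : ((q.num.natAbs * k : ℕ) : ℚ) = q * m := by
      rw [hk]; push_cast; rw [hnq, ← Rat.mul_den_eq_num]; ring
    refine ⟨q.num.natAbs * k, ?_, ?_⟩
    · rw [Finset.mem_Icc]
      constructor
      · have : (0 : ℚ) < (q.num.natAbs * k : ℕ) := by rw [hq']; positivity
        exact_mod_cast this
      · have : ((q.num.natAbs * k : ℕ) : ℚ) ≤ m := by rw [hq']; nlinarith
        exact_mod_cast this
    · rw [hq']; field_simp

open ArithmeticFunction in
/-- If the Riemann sums of `f` with all fractions of denominator `m` have bounded error, then the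
sums over reduced fractions have an error negligible compared with the number of terms. -/
theorem exists_abs_sum_slopesOfDen_sub_le {f : ℚ → ℝ} {c V : ℝ} (hV : 0 < V)
    (h : ∀ m : ℕ, 0 < m → |∑ b ∈ Finset.Icc 1 m, f (b / m) - c * m| ≤ V) {ε : ℝ} (hε : 0 < ε) :
    ∃ D : ℕ, ∀ d ≥ D,
      |∑ q ∈ slopesOfDen d, f q - c * (slopesOfDen d).card| ≤ ε * (slopesOfDen d).card := by
  obtain ⟨D, hD⟩ := exists_two_pow_card_primeFactors_le (div_pos hε hV)
  refine ⟨max D 1, fun d hd => ?_⟩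
  have hd0 : 0 < d := (le_max_right D 1).trans hd
  have hsum : ∀ m : ℕ, m > 0 → ∑ e ∈ m.divisors, (∑ q ∈ slopesOfDen e, f q - c * (slopesOfDen e).card) =
      ∑ b ∈ Finset.Icc 1 m, f (b / m) - c * m := by
    intro m hm
    have h1 := sum_divisors_slopesOfDen hm fun _ => 1
    simp only [Finset.sum_const, nsmul_eq_mul, mul_one, Nat.card_Icc, Nat.add_sub_cancel] at h1
    rw [Finset.sum_sub_distrib, sum_divisors_slopesOfDen hm, ← Finset.mul_sum, h1]
  -- Möbius inversion expresses the error over reduced fractions by full Riemann sum errors, at most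
  -- `V` for each squarefree divisor of `d`.
  have hmoeb := sum_eq_iff_sum_mul_moebius_eq.mp hsum d hd0
  rw [← hmoeb]
  calc |∑ x ∈ d.divisorsAntidiagonal, ((moebius x.1 : ℤ) : ℝ) *
        (∑ b ∈ Finset.Icc 1 x.2, f (b / x.2) - c * x.2)|
      ≤ ∑ x ∈ d.divisorsAntidiagonal, (if Squarefree x.1 then V else 0) := by
        refine (Finset.abs_sum_le_sum_abs _ _).trans (Finset.sum_le_sum fun x hx => ?_)
        have h2 : 0 < x.2 := Nat.pos_of_mem_divisors (Nat.snd_mem_divisors_of_mem_antidiagonal hx)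
        have h3 : |((moebius x.1 : ℤ) : ℝ)| = if Squarefree x.1 then 1 else 0 := by
          rw [← Int.cast_abs, abs_moebius]; split_ifs <;> simp
        rw [abs_mul, h3]
        split_ifs
        · rw [one_mul]; exact h _ h2
        · simp
    _ = ∑ e ∈ d.divisors, (if Squarefree e then V else 0) :=
        Nat.sum_divisorsAntidiagonal fun a _ => if Squarefree a then V else 0
    _ = (d.divisors.filter Squarefree).card * V := by
        rw [← Finset.sum_filter, Finset.sum_const, nsmul_eq_mul]
    _ ≤ (2 : ℝ) ^ d.primeFactors.card * V := by
        gcongr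
        exact_mod_cast card_squarefree_divisors_le hd0.ne'
    _ ≤ (ε / V * d.totient) * V := by
        gcongr
        exact hD d ((le_max_left D 1).trans hd)
    _ = ε * (slopesOfDen d).card := by rw [card_slopesOfDen hd0]; field_simp

/-! ### Riemann sums of the truncated functions -/

theorem sum_Icc_ite_lt_div {θ : ℝ} (hθ : 0 ≤ θ) {m : ℕ} (hm : 0 < m) (g : ℕ → ℝ) :
    ∑ b ∈ Finset.Icc 1 m, (if θ < ((b / m : ℚ) : ℝ) then g b else 0) =
      ∑ b ∈ Finset.Ioc ⌊θ * m⌋₊ m, g b := by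
  rw [← Finset.sum_filter]
  congr 1
  ext b
  have hm0 : (0 : ℝ) < m := by exact_mod_cast hm
  simp only [Finset.mem_filter, Finset.mem_Icc, Finset.mem_Ioc]
  rw [Nat.floor_lt (by positivity)]
  push_cast
  rw [lt_div_iff₀ hm0]
  constructor
  · rintro ⟨⟨-, h2⟩, h3⟩; exact ⟨h3, h2⟩
  · rintro ⟨h3, h2⟩
    have : (0 : ℝ) < b := lt_of_le_of_lt (by positivity) h3
    exact ⟨⟨by exact_mod_cast this, h2⟩, h3⟩

theorem sum_Ioc_cast {k m : ℕ} (h : k ≤ m) :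
    ∑ b ∈ Finset.Ioc k m, (b : ℝ) = (m * (m + 1) - k * (k + 1)) / 2 := by
  induction m, h using Nat.le_induction with
  | base => simp
  | succ m h ih => rw [Finset.sum_Ioc_succ_top h, ih]; push_cast; ring

theorem abs_sum_Icc_ite_one_sub_le {θ : ℝ} (hθ : 0 ≤ θ) (hθ1 : θ ≤ 1) {m : ℕ} (hm : 0 < m) :
    |∑ b ∈ Finset.Icc 1 m, (if θ < ((b / m : ℚ) : ℝ) then (1 : ℝ) else 0) - (1 - θ) * m| ≤ 1 := by
  have hm0 : (0 : ℝ) < m := by exact_mod_cast hm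
  have hθm : 0 ≤ θ * m := by positivity
  have hk : ⌊θ * m⌋₊ ≤ m := Nat.floor_le_of_le (by nlinarith)
  rw [sum_Icc_ite_lt_div hθ hm fun _ => 1]
  simp only [Finset.sum_const, Nat.card_Ioc, nsmul_eq_mul, mul_one]
  rw [Nat.cast_sub hk, abs_le]
  have h1 := Nat.floor_le hθm
  have h2 := Nat.lt_floor_add_one (θ * m)
  constructor <;> linarith

theorem abs_sum_Icc_ite_self_sub_le {θ : ℝ} (hθ : 0 ≤ θ) (hθ1 : θ ≤ 1) {m : ℕ} (hm : 0 < m) :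
    |∑ b ∈ Finset.Icc 1 m, (if θ < ((b / m : ℚ) : ℝ) then ((b / m : ℚ) : ℝ) else 0) -
      1 / 2 * (1 - θ ^ 2) * m| ≤ 2 := by
  have hm0 : (0 : ℝ) < m := by exact_mod_cast hm
  have hθm : 0 ≤ θ * m := by positivity
  have hk : ⌊θ * m⌋₊ ≤ m := Nat.floor_le_of_le (by nlinarith)
  have h1 := Nat.floor_le hθm
  have h2 := Nat.lt_floor_add_one (θ * m)
  rw [sum_Icc_ite_lt_div hθ hm fun b => ((b / m : ℚ) : ℝ)]
  push_cast
  rw [← Finset.sum_div, sum_Ioc_cast hk]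
  have hkm : (⌊θ * m⌋₊ : ℝ) ≤ m := by exact_mod_cast hk
  have hk0 : (0 : ℝ) ≤ ⌊θ * m⌋₊ := by positivity
  generalize (⌊θ * m⌋₊ : ℝ) = k at *
  have e : (m * (m + 1) - k * (k + 1)) / 2 / m - 1 / 2 * (1 - θ ^ 2) * m =
      ((m - k) + (θ * m - k) * (θ * m + k)) / (2 * m) := by field_simp; ring
  have h3 : (θ * m - k) * (θ * m + k) ≤ 1 * (2 * m) := by
    apply mul_le_mul <;> nlinarith
  have h4 : 0 ≤ (θ * m - k) * (θ * m + k) := mul_nonneg (by linarith) (by linarith)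
  rw [e, abs_of_nonneg (div_nonneg (by linarith) (by positivity)), div_le_iff₀ (by positivity)]
  linarith

/-- Subtract the two previous estimates: `(1 - θ) - (1 - θ ^ 2) / 2 = (1 - θ) ^ 2 / 2`, with errors
`1 + 2`. -/
theorem abs_sum_Icc_ite_one_sub_self_sub_le {θ : ℝ} (hθ : 0 ≤ θ) (hθ1 : θ ≤ 1) {m : ℕ}
    (hm : 0 < m) :
    |∑ b ∈ Finset.Icc 1 m, (if θ < ((b / m : ℚ) : ℝ) then 1 - ((b / m : ℚ) : ℝ) else 0) -
      1 / 2 * (1 - θ) ^ 2 * m| ≤ 3 := by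
  have e : ∑ b ∈ Finset.Icc 1 m, (if θ < ((b / m : ℚ) : ℝ) then 1 - ((b / m : ℚ) : ℝ) else 0) =
      ∑ b ∈ Finset.Icc 1 m, (if θ < ((b / m : ℚ) : ℝ) then (1 : ℝ) else 0) -
      ∑ b ∈ Finset.Icc 1 m, (if θ < ((b / m : ℚ) : ℝ) then ((b / m : ℚ) : ℝ) else 0) := by
    rw [← Finset.sum_sub_distrib]
    refine Finset.sum_congr rfl fun b _ => ?_
    split_ifs <;> simp
  have h1 := abs_le.mp (abs_sum_Icc_ite_one_sub_le hθ hθ1 hm)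
  have h2 := abs_le.mp (abs_sum_Icc_ite_self_sub_le hθ hθ1 hm)
  rw [e, abs_le]
  constructor <;> nlinarith

/-! ### The limits -/

/-- The mean of `(a + F w) / n`, where `F` is additive over the slopes of the path. -/
theorem tendsto_nwMean {F : List Bool → ℝ} {f : ℚ → ℝ} {a c V : ℝ} (hV : 0 < V)
    (hF : ∀ M : Multiset ℚ, (∀ q ∈ M, 0 < q ∧ q ≤ 1) →
      F (convexPath (1 ::ₘ M)) = a + (M.map fun q : ℚ => (q.den : ℝ) * f q).sum)
    (h : ∀ m : ℕ, 0 < m → |∑ b ∈ Finset.Icc 1 m, f (b / m) - c * m| ≤ V) :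
    Tendsto (fun n : ℕ => nwMean n fun w => F w / (n : ℝ)) atTop (𝓝 c) := by
  -- Size `N + 1` corresponds to multisets of total `N`; the mean is `a / (N + 1)` plus the multiset
  -- mean times `N / (N + 1)`.
  rw [← tendsto_add_atTop_iff_nat 1]
  have h1 := tendsto_mean_slopeFinset fun ε hε => exists_abs_sum_slopesOfDen_sub_le hV h hε
  have h2 := (tendsto_const_nhds (x := a)).mul (tendsto_one_div_add_atTop_nhds_zero_nat (𝕜 := ℝ))
  have h3 := h2.add (h1.mul (tendsto_natCast_div_add_atTop (1 : ℝ)))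
  rw [mul_zero, mul_one, zero_add] at h3
  refine h3.congr' ?_
  filter_upwards [eventually_ge_atTop 1] with N hN
  have hN0 : (N : ℝ) ≠ 0 := by exact_mod_cast (by omega : N ≠ 0)
  have hN1 : (N : ℝ) + 1 ≠ 0 := by positivity
  have hr : ((slopeFinset N).card : ℝ) ≠ 0 := by exact_mod_cast (card_slopeFinset_pos N).ne'
  rw [nwMean, sum_nwPaths_succ, card_nwPaths_succ, ← Finset.sum_div,
    Finset.sum_congr rfl fun M hM => hF M (mem_slopeFinset.mp hM).1, Finset.sum_add_distrib,
    Finset.sum_const, nsmul_eq_mul]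
  push_cast
  field_simp

theorem mainTheorem4 (x : ℝ) (hx : 0 ≤ x) :
    Tendsto (fun n : ℕ => nwMean n (fun w => (slopePoint w x).2 / (n : ℝ))) atTop
        (𝓝 (1 / 2 * (1 - (x / (1 + x)) ^ 2))) ∧
      Tendsto (fun n : ℕ => nwMean n (fun w => (slopePoint w x).1 / (n : ℝ))) atTop
        (𝓝 (1 / (2 * (1 + x) ^ 2))) := by
  have hx1 : 0 < 1 + x := by linarith
  have hθ : 0 ≤ x / (1 + x) := by positivity
  have hθ1 : x / (1 + x) ≤ 1 := by rw [div_le_one hx1]; linarith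
  constructor
  -- Here `a = 1` is the mandatory first north step, whose slope always exceeds the threshold.
  · refine tendsto_nwMean (F := fun w => (slopePoint w x).2) (a := 1)
      (f := fun q : ℚ => if x / (1 + x) < q then (q : ℝ) else 0) two_pos (fun M hM => ?_)
      fun m hm => abs_sum_Icc_ite_self_sub_le hθ hθ1 hm
    simp only [slopePoint_convexPath hM hx, mul_ite, mul_zero]
  · have e : 1 / (2 * (1 + x) ^ 2) = 1 / 2 * (1 - x / (1 + x)) ^ 2 := by field_simp; ring
    rw [e]
    refine tendsto_nwMean (F := fun w => (slopePoint w x).1) (a := 0)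
      (f := fun q : ℚ => if x / (1 + x) < q then 1 - (q : ℝ) else 0) three_pos (fun M hM => ?_)
      fun m hm => abs_sum_Icc_ite_one_sub_self_sub_le hθ hθ1 hm
    simp only [slopePoint_convexPath hM hx, mul_ite, mul_zero, zero_add]
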